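/- All rings are commutative with identity. For a ring $A$ and $n\ge 1$, let $\mathrm{GA}_n(A)$ be the group, under composition, of polynomial automorphisms $\varphi=(F_1,\dots,F_n)$, $F_i\in A[X_1,\dots,X_n]$, of affine $n$-space over $A$. Let $\mathrm{SA}_n(A)$ be the subgroup of those $\varphi$ whose Jacobian matrix $(\partial F_i/\partial X_j)_{i,j}$ has determinant $1$, and let $\mathrm{EA}_n(A)$ be the subgroup generated by the elementary automorphisms $(X_1,\dots,X_{i-1},X_i+f,X_{i+1},\dots,X_n)$ with $1\le i\le n$ and $f\in A[X_1,\dots,X_{i-1},X_{i+1},\dots,X_n]$. For $m\ge 0$ write $\varphi^{[m]}=(F_1,\dots,F_n,X_{n+1},\dots,X_{n+m})\in\mathrm{GA}_{n+m}(A)$. Theorem 4.3. Let $A$ be an Artinian ring and let $\varphi\in\mathrm{SA}_2(A)$. Then $\varphi$ is stably a composition of elementary automorphisms, i.e. $\varphi^{[m]}\in\mathrm{EA}_{2+m}(A)$ for some $m\ge 0$. If, in addition, $A$ is a $\mathbb{Q}$-algebra, then $\varphi\in\mathrm{EA}_2(A)$. -/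

import Mathlib

noncomputable section

namespace PolyAut

open MvPolynomial

/-- The general automorphism group `GA_n(R)` of affine `n`-space over `R`: the opposite of the
group of `R`-algebra automorphisms of `R[X_1, …, X_n]`. With the opposite multiplication the
product `φ * ψ` is the composition `φ ∘ ψ` of polynomial maps (see `coord_mul`). -/
abbrev GA (n : ℕ) (R : Type*) [CommRing R] : Type _ :=
  (MvPolynomial (Fin n) R ≃ₐ[R] MvPolynomial (Fin n) R)ᵐᵒᵖ

variable {n : ℕ} {R : Type*} [CommRing R]

/-- The vector `(F_1, …, F_n)` of polynomials that represents `φ`. -/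
def coord (φ : GA n R) (i : Fin n) : MvPolynomial (Fin n) R := φ.unop (X i)

theorem unop_apply (φ : GA n R) (p : MvPolynomial (Fin n) R) :
    φ.unop p = bind₁ (coord φ) p := by
  have h : (φ.unop : MvPolynomial (Fin n) R →ₐ[R] MvPolynomial (Fin n) R) = bind₁ (coord φ) := by
    ext i : 1
    simp [coord]
  exact DFunLike.congr_fun h p

@[simp] theorem coord_one (i : Fin n) : coord (1 : GA n R) i = X i := rfl

/-- The product in `GA_n(R)` is composition of polynomial maps: the `i`-th coordinate of `φ * ψ`
is obtained by substituting the coordinates of `ψ` into the `i`-th coordinate of `φ`. -/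
theorem coord_mul (φ ψ : GA n R) (i : Fin n) :
    coord (φ * ψ) i = bind₁ (coord ψ) (coord φ i) := by
  rw [← unop_apply]
  rfl

theorem ext_coord {φ ψ : GA n R} (h : ∀ i, coord φ i = coord ψ i) : φ = ψ := by
  apply MulOpposite.unop_injective
  ext p
  rw [unop_apply, unop_apply, show coord φ = coord ψ from funext h]

/-- The automorphism with vector representation `F`, given a vector `G` that represents its
two-sided inverse. -/
def ofVector (F G : Fin n → MvPolynomial (Fin n) R)
    (hGF : ∀ i, bind₁ G (F i) = X i) (hFG : ∀ i, bind₁ F (G i) = X i) : GA n R :=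
  MulOpposite.op <| AlgEquiv.ofAlgHom (bind₁ F) (bind₁ G)
    (by ext i : 1; simp [hFG i]) (by ext i : 1; simp [hGF i])

@[simp] theorem coord_ofVector (F G : Fin n → MvPolynomial (Fin n) R)
    (hGF : ∀ i, bind₁ G (F i) = X i) (hFG : ∀ i, bind₁ F (G i) = X i) (i : Fin n) :
    coord (ofVector F G hGF hFG) i = F i := by
  simp [coord, ofVector]

/-- The Jacobian matrix `Jφ = (∂F_i/∂X_j)`. -/
def jacobian (φ : GA n R) : Matrix (Fin n) (Fin n) (MvPolynomial (Fin n) R) :=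
  Matrix.of fun i j => pderiv j (coord φ i)

theorem pderiv_bind₁ (F : Fin n → MvPolynomial (Fin n) R) (j : Fin n)
    (p : MvPolynomial (Fin n) R) :
    pderiv j (bind₁ F p) = ∑ k, bind₁ F (pderiv k p) * pderiv j (F k) := by
  induction p using MvPolynomial.induction_on with
  | C a => simp
  | add p q hp hq => simp only [map_add, hp, hq, add_mul, Finset.sum_add_distrib]
  | mul_X p i hp =>
    simp only [map_mul, Derivation.leibniz, smul_eq_mul, hp, bind₁_X_right, map_add, add_mul,
      Finset.sum_add_distrib, pderiv_X, Finset.mul_sum]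
    congr 1
    · rw [Finset.sum_eq_single i]
      · simp
      · intro b _ hb
        simp [hb.symm]
      · simp
    · exact Finset.sum_congr rfl fun k _ => by ring

/-- The chain rule. -/
theorem jacobian_mul (φ ψ : GA n R) :
    jacobian (φ * ψ) = (jacobian φ).map (bind₁ (coord ψ)) * jacobian ψ := by
  ext1 i j
  simp [jacobian, Matrix.mul_apply, coord_mul, pderiv_bind₁]

theorem det_jacobian_mul (φ ψ : GA n R) :
    (jacobian (φ * ψ)).det = bind₁ (coord ψ) (jacobian φ).det * (jacobian ψ).det := by
  rw [jacobian_mul, Matrix.det_mul, AlgHom.map_det]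
  rfl

theorem jacobian_one : jacobian (1 : GA n R) = 1 := by
  ext1 i j
  simp [jacobian, pderiv_X, Matrix.one_apply, Pi.single_apply]

/-- The special automorphism group `SA_n(R)`: the automorphisms with Jacobian determinant `1`. -/
def SA (n : ℕ) (R : Type*) [CommRing R] : Subgroup (GA n R) where
  carrier := {φ | (jacobian φ).det = 1}
  one_mem' := by simp [jacobian_one]
  mul_mem' := by
    intro φ ψ hφ hψ
    simp only [Set.mem_ofPred_eq] at hφ hψ ⊢
    rw [det_jacobian_mul, hφ, hψ, map_one, one_mul]
  inv_mem' := by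
    intro φ hφ
    simp only [Set.mem_ofPred_eq] at hφ ⊢
    have h := det_jacobian_mul φ φ⁻¹
    rw [mul_inv_cancel, jacobian_one, Matrix.det_one, hφ, map_one, one_mul] at h
    exact h.symm

theorem bind₁_eq_self_of_mem_supported {i : Fin n} {F : Fin n → MvPolynomial (Fin n) R}
    (hF : ∀ j, j ≠ i → F j = X j) {f : MvPolynomial (Fin n) R}
    (hf : f ∈ supported R ({i}ᶜ : Set (Fin n))) : bind₁ F f = f := by
  rw [supported_eq_range_rename] at hf
  obtain ⟨g, rfl⟩ := hf
  change bind₁ F (rename _ g) = rename _ g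
  rw [bind₁_rename, show F ∘ (Subtype.val : ({i}ᶜ : Set (Fin n)) → Fin n) = X ∘ Subtype.val from
    funext fun j => hF j j.2]
  have h : bind₁ (X ∘ (Subtype.val : ({i}ᶜ : Set (Fin n)) → Fin n)) =
      (rename Subtype.val : MvPolynomial _ R →ₐ[R] MvPolynomial (Fin n) R) := by
    ext j : 1
    simp
  exact DFunLike.congr_fun h g

/-- The elementary automorphism
`e_i(f) = (X_1, …, X_{i-1}, X_i + f, X_{i+1}, …, X_n)`,
where `f` is a polynomial in the variables other than `X_i`. -/
def elementary (i : Fin n) (f : supported R ({i}ᶜ : Set (Fin n))) : GA n R :=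
  ofVector
    (fun j => if j = i then X i + (f : MvPolynomial (Fin n) R) else X j)
    (fun j => if j = i then X i - (f : MvPolynomial (Fin n) R) else X j)
    (fun j => by
      by_cases h : j = i
      · subst h
        simp only [if_true, map_add, bind₁_X_right]
        rw [bind₁_eq_self_of_mem_supported (fun k hk => if_neg hk) f.2, sub_add_cancel]
      · simp [h])
    (fun j => by
      by_cases h : j = i
      · subst h
        simp only [if_true, map_sub, bind₁_X_right]
        rw [bind₁_eq_self_of_mem_supported (fun k hk => if_neg hk) f.2, add_sub_cancel_right]
      · simp [h])

theorem coord_elementary (i : Fin n) (f : supported R ({i}ᶜ : Set (Fin n))) (j : Fin n) :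
    coord (elementary i f) j = if j = i then X i + (f : MvPolynomial (Fin n) R) else X j := by
  simp [elementary]

/-- `EA_n(R)`: the subgroup generated by the elementary automorphisms. -/
def EA (n : ℕ) (R : Type*) [CommRing R] : Subgroup (GA n R) :=
  Subgroup.closure {φ | ∃ i f, φ = elementary i f}

/-- The vector `(F_1, …, F_n, X_{n+1}, …, X_{n+m})`. -/
def stabVector (m : ℕ) (F : Fin n → MvPolynomial (Fin n) R) :
    Fin (n + m) → MvPolynomial (Fin (n + m)) R :=
  Fin.append (fun i => rename (Fin.castAdd m) (F i)) (fun j => X (Fin.natAdd n j))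

theorem bind₁_stabVector (m : ℕ) (F G : Fin n → MvPolynomial (Fin n) R) (i : Fin (n + m)) :
    bind₁ (stabVector m G) (stabVector m F i) = stabVector m (fun k => bind₁ G (F k)) i := by
  refine Fin.addCases (fun i => ?_) (fun j => ?_) i
  · simp only [stabVector, Fin.append_left, bind₁_rename, rename_bind₁]
    congr 2
    funext k
    simp
  · simp [stabVector]

theorem stabVector_X (m : ℕ) :
    stabVector m (X : Fin n → MvPolynomial (Fin n) R) = X := by
  funext i
  refine Fin.addCases (fun i => ?_) (fun j => ?_) i <;> simp [stabVector]

/-- The automorphism `φ^{[m]} = (F_1, …, F_n, X_{n+1}, …, X_{n+m})`. -/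
def stabFun (m : ℕ) (φ : GA n R) : GA (n + m) R :=
  ofVector (stabVector m (coord φ)) (stabVector m (coord φ⁻¹))
    (fun i => by
      rw [bind₁_stabVector]
      simp only [← coord_mul, mul_inv_cancel]
      exact congrFun (stabVector_X m) i)
    (fun i => by
      rw [bind₁_stabVector]
      simp only [← coord_mul, inv_mul_cancel]
      exact congrFun (stabVector_X m) i)

theorem coord_stabFun (m : ℕ) (φ : GA n R) :
    coord (stabFun m φ) = stabVector m (coord φ) := by
  funext i
  rw [stabFun, coord_ofVector]

/-- The stabilization homomorphism `GA_n(R) → GA_{n+m}(R)`, `φ ↦ φ^{[m]}`. -/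
def stab (m : ℕ) : GA n R →* GA (n + m) R where
  toFun := stabFun m
  map_one' := ext_coord fun i => by
    rw [coord_stabFun]
    exact congrFun (stabVector_X m) i
  map_mul' φ ψ := ext_coord fun i => by
    rw [coord_mul, coord_stabFun, coord_stabFun, coord_stabFun, bind₁_stabVector,
      show coord (φ * ψ) = fun k => bind₁ (coord ψ) (coord φ k) from funext (coord_mul φ ψ)]

end PolyAut

end

/-! Modulo its nilradical, which is nilpotent, an Artinian ring is a finite product of fields. So
two facts are needed: over a field every special automorphism of the plane is a product of
elementary ones, and this property lifts along square-zero ideals, after stabilization in general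
and without it over `ℚ`.

Fields (`SA_two_le_EA_two`, in every characteristic). For an automorphism `(F, G)` with `deg F ≤ deg
G` and `deg G ≥ 2`, the leading form of `G` must be a constant times the leading form of a power of
`F` (`exists_reduction`), so a shear lowers the degree. Otherwise, view `k[F, G]` inside `k(F)[G]`
and control degrees there by key polynomials in the style of MacLane. Each new key polynomial
records a cancellation of leading terms by some amount `e`, and the same `e` is added to the degree
of the logarithmic bracket `Jac(m, u) / (m u)` (`IsKeyStage.next`). That degree starts at `-deg F -
deg G`, because the Jacobian is a unit, and never exceeds `-2`. So the process stops, and all key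
values met keep degree at least 2. Hence every element of `k[F, G]` that really involves `G` has
degree at least 2; both coordinates then lie in `k(F)` and have proportional leading forms, which is
absurd.

Square-zero lifting. If `J² = 0`, the automorphisms `X + h` with `h` in `J` compose by addition, and
the Jacobian condition says that `h` has divergence zero. The fields `H` for which every `aH`, `a ∈
J`, integrates to an elementary product form an `A`-module `tangentEA`, stable under conjugation by
elementary automorphisms; the problem is now linear. With two extra variables the module contains
all `p ∂_i - (∂_i p) z ∂_z`, and the `z`-parts cancel when these are summed over `h`
(`stab_two_mem_EA_of_congr`). Over `ℚ` a Vandermonde argument on the conjugates of `x^d ∂_y` gives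
enough divergence-free fields in the plane itself (`mem_EA_two_of_congr`). -/

noncomputable section

namespace PolyAut

open scoped WithZero
open WithZero (exp log)

/-! ### Degrees and the logarithmic Jacobian bracket -/

section Degree

variable {k K : Type*} [Field k] [Field K] [Algebra k K] (v : Valuation K ℤᵐ⁰)

/-- The integer-valued degree attached to a valuation with values in `ℤᵐ⁰`. -/
def valDeg (x : Kˣ) : ℤ := log (v x)

theorem val_eq_exp_valDeg (x : Kˣ) : v x = exp (valDeg v x) :=
  (WithZero.exp_log (v.ne_zero_of_unit x)).symm

theorem valDeg_eq_iff {x : Kˣ} {n : ℤ} : valDeg v x = n ↔ v x = exp n := by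
  rw [val_eq_exp_valDeg, WithZero.exp_inj]

theorem valDeg_mul (x y : Kˣ) : valDeg v (x * y) = valDeg v x + valDeg v y := by
  rw [valDeg, Units.val_mul, map_mul,
    WithZero.log_mul (v.ne_zero_of_unit x) (v.ne_zero_of_unit y)]
  rfl

theorem valDeg_zpow (x : Kˣ) (n : ℤ) : valDeg v (x ^ n) = n * valDeg v x := by
  rw [valDeg, Units.val_zpow_eq_zpow_val, map_zpow₀, WithZero.log_zpow]
  rfl

theorem valDeg_pow (x : Kˣ) (n : ℕ) : valDeg v (x ^ n) = n * valDeg v x := by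
  rw [← zpow_natCast, valDeg_zpow]

theorem valDeg_inv (x : Kˣ) : valDeg v x⁻¹ = -valDeg v x := by
  rw [← zpow_neg_one, valDeg_zpow, neg_one_mul]

theorem valDeg_div (x y : Kˣ) : valDeg v (x / y) = valDeg v x - valDeg v y := by
  rw [div_eq_mul_inv, valDeg_mul, valDeg_inv, sub_eq_add_neg]

theorem val_eq_one_iff_valDeg {x : Kˣ} : v x = 1 ↔ valDeg v x = 0 := by
  rw [valDeg_eq_iff, WithZero.exp_zero]

/-- The logarithmic derivative of a unit. -/
def logDer (D : Derivation k K K) : Kˣ →* Multiplicative K where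
  toFun x := Multiplicative.ofAdd ((x : K)⁻¹ * D x)
  map_one' := by simp
  map_mul' x y := by
    rw [← ofAdd_add]
    congr 1
    have hx := x.ne_zero
    have hy := y.ne_zero
    simp only [Units.val_mul, Derivation.leibniz, smul_eq_mul]
    field_simp
    ring

theorem toAdd_logDer (D : Derivation k K K) (x : Kˣ) :
    (logDer D x).toAdd = (x : K)⁻¹ * D x := rfl

variable (D₁ D₂ : Derivation k K K)

/-- The logarithmic Jacobian bracket of two units with respect to two derivations. -/
def logBr (x y : Kˣ) : K :=
  (logDer D₁ x).toAdd * (logDer D₂ y).toAdd - (logDer D₂ x).toAdd * (logDer D₁ y).toAdd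

theorem logBr_mul_left (x x' y : Kˣ) :
    logBr D₁ D₂ (x * x') y = logBr D₁ D₂ x y + logBr D₁ D₂ x' y := by
  simp only [logBr, map_mul, toAdd_mul]
  ring

theorem logBr_swap (x y : Kˣ) : logBr D₁ D₂ y x = -logBr D₁ D₂ x y := by
  simp only [logBr]
  ring

theorem logBr_mul_right (x y y' : Kˣ) :
    logBr D₁ D₂ x (y * y') = logBr D₁ D₂ x y + logBr D₁ D₂ x y' := by
  simp only [logBr, map_mul, toAdd_mul]
  ring

theorem logBr_zpow_left (x y : Kˣ) (n : ℤ) :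
    logBr D₁ D₂ (x ^ n) y = n * logBr D₁ D₂ x y := by
  simp only [logBr, map_zpow, toAdd_zpow, zsmul_eq_mul]
  ring

theorem logBr_zpow_right (x y : Kˣ) (n : ℤ) :
    logBr D₁ D₂ x (y ^ n) = n * logBr D₁ D₂ x y := by
  simp only [logBr, map_zpow, toAdd_zpow, zsmul_eq_mul]
  ring

theorem logBr_pow_right (x y : Kˣ) (n : ℕ) :
    logBr D₁ D₂ x (y ^ n) = n * logBr D₁ D₂ x y := by
  have := logBr_zpow_right D₁ D₂ x y n
  simpa using this

theorem logBr_inv_right (x y : Kˣ) :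
    logBr D₁ D₂ x y⁻¹ = - logBr D₁ D₂ x y := by
  have := logBr_zpow_right D₁ D₂ x y (-1)
  simpa using this

theorem logBr_self (x : Kˣ) : logBr D₁ D₂ x x = 0 := by
  simp only [logBr]
  ring

/-- The bracket with a unit `T` that differs from `T'` by a constant. -/
theorem mul_logBr_of_sub_const (x T T' : Kˣ) (c : k) (h : (T' : K) = T - algebraMap k K c) :
    (T' : K) * logBr D₁ D₂ x T' = T * logBr D₁ D₂ x T := by
  have hT := T.ne_zero
  have hT' := T'.ne_zero
  have e (D : Derivation k K K) : D T' = D T := by rw [h]; simp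
  simp only [logBr, toAdd_logDer, e]
  field_simp

theorem logBr_of_eq_const (x T : Kˣ) (c : k) (h : (T : K) = algebraMap k K c) :
    logBr D₁ D₂ x T = 0 := by
  simp [logBr, toAdd_logDer, h]

variable {v D₁ D₂}

/-- Each logarithmic derivative has degree at most `-1`. This universal bound is what makes the
construction of key polynomials terminate. -/
theorem val_logBr_le (h₁ : ∀ x, v (D₁ x) ≤ v x * exp (-1 : ℤ))
    (h₂ : ∀ x, v (D₂ x) ≤ v x * exp (-1 : ℤ)) (x y : Kˣ) :
    v (logBr D₁ D₂ x y) ≤ exp (-2 : ℤ) := by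
  have key (D : Derivation k K K) (h : ∀ x, v (D x) ≤ v x * exp (-1 : ℤ)) (x : Kˣ) :
      v (logDer D x).toAdd ≤ exp (-1 : ℤ) := by
    rw [toAdd_logDer, map_mul, map_inv₀]
    refine (mul_le_mul_right (h x) _).trans ?_
    rw [← mul_assoc, inv_mul_cancel₀ (v.ne_zero_of_unit x), one_mul]
  have e : exp (-2 : ℤ) = exp (-1 : ℤ) * exp (-1 : ℤ) := by
    rw [← WithZero.exp_add]; norm_num
  refine v.map_sub_le ?_ ?_ <;> rw [map_mul, e] <;>
    exact mul_le_mul' (key _ (by assumption) _) (key _ (by assumption) _)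

end Degree

end PolyAut

end

noncomputable section

namespace PolyAut

open scoped WithZero
open WithZero (exp log)

/-! ### Expansion in powers of a monic polynomial -/

section Expansion

open Polynomial

/-- Repeated division by `U`. As `U` is monic, the quotient keeps the leading coefficient, so that
of `P` survives down to the last digit `c N`. -/
theorem exists_adic_expansion {E : Type*} [Field E] {U : E[X]} (hU : U.Monic)
    (hU0 : 0 < U.natDegree) (P : E[X]) (hP : P ≠ 0) :
    ∃ (N : ℕ) (c : ℕ → E[X]), (∀ j, (c j).degree < U.degree) ∧ c N ≠ 0 ∧
      P = ∑ j ∈ Finset.range (N + 1), c j * U ^ j ∧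
      (c N).leadingCoeff = P.leadingCoeff ∧
      P.natDegree = (c N).natDegree + N * U.natDegree := by
  induction h : P.natDegree using Nat.strong_induction_on generalizing P with
  | _ e ih =>
    subst h
    by_cases hlt : P.degree < U.degree
    · refine ⟨0, fun _ => P, fun _ => hlt, hP, by simp, rfl, by simp⟩
    · have hdiv : P %ₘ U + U * (P /ₘ U) = P := modByMonic_add_div P U
      have hQ : P /ₘ U ≠ 0 := fun h => hlt ((divByMonic_eq_zero_iff hU).1 h)
      have hdeg : (P /ₘ U).natDegree = P.natDegree - U.natDegree := natDegree_divByMonic P hU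
      have hle : U.natDegree ≤ P.natDegree := natDegree_le_natDegree (not_lt.1 hlt)
      obtain ⟨N, c, hc, hN, hsum, hlead, hnat⟩ := ih _ (by omega) (P /ₘ U) hQ rfl
      refine ⟨N + 1, fun j => if j = 0 then P %ₘ U else c (j - 1), fun j => ?_, by simpa using hN,
        ?_, ?_, ?_⟩
      · dsimp only
        split_ifs
        · exact degree_modByMonic_lt P hU
        · exact hc _
      · rw [Finset.sum_range_succ']
        simp only [Nat.add_eq_zero_iff, one_ne_zero, and_false, if_false, add_tsub_cancel_right,
          if_true, pow_zero, mul_one, pow_succ, ← mul_assoc]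
        rw [← Finset.sum_mul, ← hsum]
        conv_lhs => rw [← hdiv]
        ring
      · simp only [Nat.add_eq_zero_iff, one_ne_zero, and_false, if_false, add_tsub_cancel_right]
        rw [hlead, leadingCoeff_divByMonic_of_monic hU (not_lt.1 hlt)]
      · simp only [Nat.add_eq_zero_iff, one_ne_zero, and_false, if_false, add_tsub_cancel_right]
        rw [add_mul, one_mul, ← add_assoc, ← hnat]
        omega

end Expansion

/-! ### Key polynomial stages -/

section Stage

open Polynomial

variable {k K : Type*} [Field k] [Field K] [Algebra k K]

/-- A stage in the construction of key polynomials for the subalgebra `E[G]` of a field with a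
degree valuation `v`: the polynomial `U` is the current key polynomial, `u = U(G)`, and `M` is the
group of Laurent monomials in the earlier ones, whose degrees form the group `dℤ`. -/
structure IsKeyStage (v : Valuation K ℤᵐ⁰) (D₁ D₂ : Derivation k K K)
    (E : IntermediateField k K) (G : K) (M : Subgroup Kˣ) (u : Kˣ) (U : E[X]) (d : ℕ) (ω : K) :
    Prop where
  monic : U.Monic
  natDegree_pos : 0 < U.natDegree
  aeval_eq : aeval G U = (u : K)
  d_pos : 0 < d
  dvd_valDeg : ∀ m ∈ M, (d : ℤ) ∣ valDeg v m
  exists_poly : ∀ r : ℤ, ∃ m ∈ M, ∃ P : E[X], P.degree < U.degree ∧ aeval G P = (m : K) ∧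
    valDeg v m = d * r
  residue : ∀ m ∈ M, valDeg v m = 0 → ∃ c : k, v ((m : K) - algebraMap k K c) < 1
  top : ∀ P : E[X], P ≠ 0 → P.degree < U.degree → ∃ m ∈ M, ∃ c : k, c ≠ 0 ∧
    v (aeval G P - algebraMap k K c * m) < v m
  -- The condition on the leading coefficient holds for elements of `k[F][G]`; it excludes
  -- denominators of positive degree.
  one_le : ∀ P : E[X], P ≠ 0 → P.degree < U.degree → 1 ≤ v (P.leadingCoeff : K) →
    1 ≤ v (aeval G P)
  two_le : ∀ P : E[X], P ≠ 0 → P.degree < U.degree → 1 ≤ v (P.leadingCoeff : K) →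
    0 < P.natDegree → exp (2 : ℤ) ≤ v (aeval G P)
  ne_zero : ω ≠ 0
  br_mem : ∀ m ∈ M, ∀ m' ∈ M, v (logBr D₁ D₂ m m') < v ω
  -- To leading order the bracket with `u` depends only on the degree of `m`, linearly, with `ω` as
  -- unit.
  br_key : ∀ m ∈ M, ∀ r : ℤ, valDeg v m = d * r → v (logBr D₁ D₂ m u - r * ω) < v ω

variable {v : Valuation K ℤᵐ⁰} {D₁ D₂ : Derivation k K K}
    {E : IntermediateField k K} {G : K} {M : Subgroup Kˣ} {u : Kˣ} {U : E[X]} {d : ℕ} {ω : K}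

theorem val_eq_of_val_sub_const_mul_lt (hk : ∀ c : k, c ≠ 0 → v (algebraMap k K c) = 1)
    {x m : K} {c : k} (hc : c ≠ 0) (h : v (x - algebraMap k K c * m) < v m) : v x = v m := by
  have e : v (algebraMap k K c * m) = v m := by rw [map_mul, hk c hc, one_mul]
  rw [← e] at h
  rw [v.map_eq_of_sub_lt h, e]

/-- Each digit `c j` has a leading term `γ j * m j`. Two terms `m j * u ^ j` of equal degree have
indices congruent mod `n`, and since `u ^ n = Q * T` they differ by a power of `T` and a unit of
constant residue. So all terms of maximal degree add up to one monomial times a polynomial `p` in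
`T`, and cancellation can only come from `p(T)`. -/
theorem IsKeyStage.expansion_top (hk : ∀ c : k, c ≠ 0 → v (algebraMap k K c) = 1)
    (S : IsKeyStage v D₁ D₂ E G M u U d ω) {n : ℕ}
    (hdvd : ∀ j : ℤ, (d : ℤ) ∣ j * valDeg v u → (n : ℤ) ∣ j) {Q T : Kˣ} (hQ : Q ∈ M)
    (hT : u ^ n = Q * T) (hT0 : valDeg v T = 0)
    {N : ℕ} {c : ℕ → E[X]} (hc : ∀ j, (c j).degree < U.degree) (hN : c N ≠ 0) :
    ∃ m ∈ M, ∃ (j₀ : ℕ) (p : k[X]), p ≠ 0 ∧ p.natDegree ≤ N / n ∧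
      v (aeval G (∑ j ∈ Finset.range (N + 1), c j * U ^ j) - (m * u ^ j₀ : Kˣ) * aeval (T : K) p) <
        v (m * u ^ j₀ : Kˣ) ∧
      v (aeval G (c N)) * v u ^ N ≤ v (m * u ^ j₀ : Kˣ) := by
  classical
  have htop : ∀ j, ∃ (m : Kˣ) (γ : k), m ∈ M ∧ (c j ≠ 0 → γ ≠ 0 ∧
      v (aeval G (c j) - algebraMap k K γ * m) < v m) := by
    intro j
    by_cases h : c j = 0
    · exact ⟨1, 0, M.one_mem, fun h' => absurd h h'⟩
    · obtain ⟨m, hm, γ, h1, h2⟩ := S.top _ h (hc j)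
      exact ⟨m, γ, hm, fun _ => ⟨h1, h2⟩⟩
  choose m γ hm hγ using htop
  have hval : ∀ j, c j ≠ 0 → v (aeval G (c j)) = v (m j) := fun j hj =>
    val_eq_of_val_sub_const_mul_lt hk (hγ j hj).1 (hγ j hj).2
  -- The index `s` of a term of maximal degree; the common monomial `B` is that term with its power
  -- of `T` removed.
  obtain ⟨s, hsJ, hmax⟩ := Finset.exists_max_image
    ((Finset.range (N + 1)).filter fun j => c j ≠ 0) (fun j => valDeg v (m j * u ^ j))
    ⟨N, by simp [hN]⟩
  simp only [Finset.mem_filter, Finset.mem_range] at hsJ hmax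
  have hmax' : ∀ j, j < N + 1 → c j ≠ 0 → v (m j * u ^ j : Kˣ) ≤ v (m s * u ^ s : Kˣ) := by
    intro j h1 h2
    rw [val_eq_exp_valDeg, val_eq_exp_valDeg, WithZero.exp_le_exp]
    exact hmax j ⟨h1, h2⟩
  have hsplit : ∀ j, u ^ j = Q ^ (j / n) * T ^ (j / n) * u ^ (j % n) := by
    intro j
    rw [← mul_pow, ← hT, ← pow_mul, ← pow_add, Nat.div_add_mod]
  obtain ⟨B, hB⟩ : ∃ B : Kˣ, B = m s * Q ^ (s / n) * u ^ (s % n) := ⟨_, rfl⟩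
  have hmB : m s * u ^ s = B * T ^ (s / n) := by
    rw [hsplit s, hB]
    apply Units.ext
    push_cast
    ring
  have hTp : ∀ l : ℕ, v ((T ^ l : Kˣ) : K) = 1 := fun l => by
    rw [val_eq_one_iff_valDeg, valDeg_pow, hT0, mul_zero]
  have hvB : v B = v (m s * u ^ s : Kˣ) := by
    rw [hmB, Units.val_mul, map_mul, hTp, mul_one]
  have hJ : ∀ j, valDeg v (m j * u ^ j) = valDeg v (m s * u ^ s) → j % n = s % n ∧
      ∃ c' : k, c' ≠ 0 ∧ v (((m j * u ^ j : Kˣ) : K) - B * algebraMap k K c' * T ^ (j / n)) < v B := by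
    intro j hj
    have hmod : j % n = s % n := by
      have h1 : (d : ℤ) ∣ ((s : ℤ) - j) * valDeg v u := by
        rw [valDeg_mul, valDeg_mul, valDeg_pow, valDeg_pow] at hj
        have : ((s : ℤ) - j) * valDeg v u = valDeg v (m j) - valDeg v (m s) := by linarith
        rw [this]
        exact dvd_sub (S.dvd_valDeg _ (hm j)) (S.dvd_valDeg _ (hm s))
      exact (Nat.modEq_iff_dvd.2 (hdvd _ h1))
    refine ⟨hmod, ?_⟩
    -- The ratio of two top terms, after their powers of `T` are split off, is an element of `M` of
    -- degree zero, hence constant to leading order.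
    obtain ⟨ρ, hρ⟩ : ∃ ρ : Kˣ, ρ = m j * Q ^ (j / n) / (m s * Q ^ (s / n)) := ⟨_, rfl⟩
    have hρM : ρ ∈ M := hρ ▸ M.div_mem (M.mul_mem (hm j) (M.pow_mem hQ _))
      (M.mul_mem (hm s) (M.pow_mem hQ _))
    have hj' : m j * u ^ j = B * ρ * T ^ (j / n) := by
      rw [hsplit j, hmod, hB, hρ]
      apply Units.ext
      push_cast
      have := (m s).ne_zero
      have := Q.ne_zero
      field_simp
    have hρ0 : valDeg v ρ = 0 := by
      have := hj
      rw [hj', hmB, valDeg_mul, valDeg_mul, valDeg_mul, valDeg_pow, valDeg_pow, hT0] at this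
      linarith
    obtain ⟨c', hc'⟩ := S.residue ρ hρM hρ0
    have hv1 : v ρ = 1 := (val_eq_one_iff_valDeg v).2 hρ0
    refine ⟨c', ?_, ?_⟩
    · rintro rfl
      rw [map_zero, sub_zero, hv1] at hc'
      exact lt_irrefl _ hc'
    · have e : ((m j * u ^ j : Kˣ) : K) - B * algebraMap k K c' * T ^ (j / n) =
          (B * T ^ (j / n) : Kˣ) * (ρ - algebraMap k K c') := by
        rw [hj']
        push_cast
        ring
      rw [e, map_mul, Units.val_mul, map_mul, hTp, mul_one]
      exact mul_lt_of_lt_one_right (by rw [zero_lt_iff]; exact v.ne_zero_of_unit B) hc'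
  choose! hJmod c' hc'0 hc' using hJ
  set J := (Finset.range (N + 1)).filter
    (fun j => c j ≠ 0 ∧ valDeg v (m j * u ^ j) = valDeg v (m s * u ^ s)) with hJdef
  set p : k[X] := ∑ j ∈ J, Polynomial.monomial (j / n) (γ j * c' j) with hp
  refine ⟨m s * Q ^ (s / n), M.mul_mem (hm s) (M.pow_mem hQ _), s % n, p, ?_, ?_, ?_, ?_⟩
  · intro h0
    -- Top indices share their remainder mod `n`, so distinct ones have distinct quotients and no
    -- coefficients of `p` are merged.
    have h1 : p.coeff (s / n) = γ s * c' s := by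
      rw [hp, finsetSum_coeff, Finset.sum_eq_single s]
      · simp
      · intro j hj hjs
        rw [coeff_monomial, if_neg]
        intro hdiv
        apply hjs
        have h2 := hJmod j (by simp [hJdef] at hj; exact hj.2.2)
        rw [← Nat.div_add_mod j n, ← Nat.div_add_mod s n, h2, hdiv]
      · intro h
        exact absurd (by simp [hJdef, hsJ]) h
    rw [h0, coeff_zero] at h1
    exact mul_ne_zero (hγ s hsJ.2).1 (hc'0 s rfl) h1.symm
  · rw [hp]
    refine natDegree_sum_le_of_forall_le _ _ fun j hj => ?_
    refine (natDegree_monomial_le _).trans (Nat.div_le_div_right ?_)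
    simp [hJdef] at hj
    omega
  · rw [← hB]
    have hsum : aeval G (∑ j ∈ Finset.range (N + 1), c j * U ^ j) - B * aeval (T : K) p =
        ∑ j ∈ Finset.range (N + 1), (aeval G (c j) * u ^ j -
          if j ∈ J then B * (algebraMap k K (γ j * c' j) * T ^ (j / n)) else 0) := by
      rw [Finset.sum_sub_distrib, hp]
      simp only [map_sum, map_mul, map_pow, S.aeval_eq, aeval_monomial]
      congr 1
      rw [← Finset.sum_filter, Finset.mul_sum]
      refine Finset.sum_congr ?_ fun _ _ => rfl
      ext j
      simp [hJdef]
    rw [hsum]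
    refine v.map_sum_lt (v.ne_zero_of_unit B) fun j hj => ?_
    rw [Finset.mem_range] at hj
    by_cases hcj : c j = 0
    · rw [if_neg (by simp [hJdef, hcj]), hcj]
      simp only [map_zero, zero_mul, sub_zero]
      rw [zero_lt_iff]; exact v.ne_zero_of_unit B
    by_cases hjJ : j ∈ J
    · rw [if_pos hjJ]
      have hjv := (Finset.mem_filter.1 hjJ).2.2
      have e : aeval G (c j) * (u : K) ^ j - B * (algebraMap k K (γ j * c' j) * T ^ (j / n)) =
          (aeval G (c j) - algebraMap k K (γ j) * m j) * (u : K) ^ j +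
          algebraMap k K (γ j) *
            (((m j * u ^ j : Kˣ) : K) - B * algebraMap k K (c' j) * T ^ (j / n)) := by
        rw [map_mul, Units.val_mul, Units.val_pow_eq_pow_val]
        ring
      rw [e]
      refine v.map_add_lt ?_ ?_
      · refine lt_of_lt_of_le ?_ ((hmax' j hj hcj).trans hvB.ge)
        rw [map_mul, Units.val_mul, map_mul, Units.val_pow_eq_pow_val]
        refine mul_lt_mul_of_pos_right (hγ j hcj).2 ?_
        rw [zero_lt_iff, v.ne_zero_iff]
        exact pow_ne_zero _ u.ne_zero
      · rw [map_mul, hk _ (hγ j hcj).1, one_mul]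
        exact hc' j hjv
    · rw [if_neg hjJ, sub_zero, map_mul, hval j hcj, ← map_mul, hvB]
      have : valDeg v (m j * u ^ j) ≠ valDeg v (m s * u ^ s) := fun h =>
        hjJ (by simp [hJdef, hj, hcj, h])
      have := lt_of_le_of_ne (hmax j ⟨hj, hcj⟩) this
      rw [← WithZero.exp_lt_exp, ← val_eq_exp_valDeg, ← val_eq_exp_valDeg] at this
      simpa using this
  · rw [← hB, hvB]
    refine le_trans (le_of_eq ?_) (hmax' N (Nat.lt_succ_self N) hN)
    rw [hval N hN]
    simp

end Stage

end PolyAut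

end

noncomputable section

namespace PolyAut

open scoped WithZero
open WithZero (exp log)

/-! ### Passage from one key polynomial to the next -/

section Step

open Polynomial

variable {k K : Type*} [Field k] [Field K] [Algebra k K]

/-- The units with nonzero constant residue. -/
def residueConst (v : Valuation K ℤᵐ⁰) (hk : ∀ c : k, c ≠ 0 → v (algebraMap k K c) = 1) :
    Subgroup Kˣ where
  carrier := {x | ∃ c : k, c ≠ 0 ∧ v ((x : K) - algebraMap k K c) < 1}
  one_mem' := ⟨1, one_ne_zero, by simp⟩
  mul_mem' := by
    rintro x y ⟨c, hc, hx⟩ ⟨c', hc', hy⟩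
    refine ⟨c * c', mul_ne_zero hc hc', ?_⟩
    have e : ((x * y : Kˣ) : K) - algebraMap k K (c * c') =
        (x - algebraMap k K c) * y + algebraMap k K c * (y - algebraMap k K c') := by
      rw [map_mul, Units.val_mul]
      ring
    have hvy : v y = 1 := by
      rw [← hk c' hc'] at hy ⊢
      exact v.map_eq_of_sub_lt hy
    rw [e]
    refine v.map_add_lt ?_ ?_
    · rwa [map_mul, hvy, mul_one]
    · rwa [map_mul, hk c hc, one_mul]
  inv_mem' := by
    rintro x ⟨c, hc, hx⟩
    refine ⟨c⁻¹, inv_ne_zero hc, ?_⟩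
    have hvx : v x = 1 := by
      rw [← hk c hc] at hx ⊢
      exact v.map_eq_of_sub_lt hx
    have e : ((x⁻¹ : Kˣ) : K) - algebraMap k K c⁻¹ =
        -((x : K)⁻¹ * (algebraMap k K c)⁻¹ * (x - algebraMap k K c)) := by
      have h1 := x.ne_zero
      have h2 : algebraMap k K c ≠ 0 := by simpa using hc
      rw [map_inv₀, Units.val_inv_eq_inv_val]
      field_simp
      ring
    rw [e, Valuation.map_neg, map_mul, map_mul, map_inv₀, map_inv₀, hvx, hk c hc]
    simpa using hx

theorem mem_residueConst_of_val_eq_one {v : Valuation K ℤᵐ⁰}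
    {hk : ∀ c : k, c ≠ 0 → v (algebraMap k K c) = 1} {x : Kˣ} (hx : valDeg v x = 0) {c : k}
    (h : v ((x : K) - algebraMap k K c) < 1) : x ∈ residueConst v hk := by
  refine ⟨c, ?_, h⟩
  rintro rfl
  rw [map_zero, sub_zero, (val_eq_one_iff_valDeg v).2 hx] at h
  exact lt_irrefl _ h

theorem val_intCast_mul_le (v : Valuation K ℤᵐ⁰)
    (hk : ∀ c : k, c ≠ 0 → v (algebraMap k K c) = 1) (n : ℤ) (x : K) : v (n * x) ≤ v x := by
  by_cases h : (n : k) = 0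
  · have : (n : K) = 0 := by rw [← map_intCast (algebraMap k K), h, map_zero]
    simp [this]
  · rw [map_mul, ← map_intCast (algebraMap k K), hk _ h, one_mul]

variable {v : Valuation K ℤᵐ⁰} {D₁ D₂ : Derivation k K K}
    {E : IntermediateField k K} {G : K} {M : Subgroup Kˣ} {u : Kˣ} {U : E[X]} {d : ℕ} {ω : K}

theorem IsKeyStage.val_br_le (hk : ∀ c : k, c ≠ 0 → v (algebraMap k K c) = 1)
    (S : IsKeyStage v D₁ D₂ E G M u U d ω) {m : Kˣ} (hm : m ∈ M) :
    v (logBr D₁ D₂ m u) ≤ v ω := by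
  obtain ⟨r, hr⟩ := S.dvd_valDeg m hm
  rw [← sub_add_cancel (logBr D₁ D₂ m u) (r * ω)]
  exact v.map_add_le (S.br_key m hm r hr).le (val_intCast_mul_le v hk r ω)

/-- Numerical data and the degree-zero quotient `T = uⁿ / Q` attached to a stage. -/
theorem IsKeyStage.exists_quotient (S : IsKeyStage v D₁ D₂ E G M u U d ω) :
    ∃ (n d' : ℕ) (δ : ℤ) (Q T : Kˣ) (PQ : E[X]), 0 < n ∧ 0 < d' ∧ d = n * d' ∧
      valDeg v u = d' * δ ∧ IsCoprime (n : ℤ) δ ∧ Q ∈ M ∧ PQ.degree < U.degree ∧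
      aeval G PQ = (Q : K) ∧ valDeg v Q = d * δ ∧ u ^ n = Q * T ∧ valDeg v T = 0 := by
  have hd := S.d_pos
  -- With `g = gcd(d, deg u)`, the new `d'` is `g` and `n = d / g` is the least exponent for which
  -- `deg (u ^ n)` lies in `dℤ`.
  have hg : 0 < Int.gcd d (valDeg v u) := Int.gcd_pos_of_ne_zero_left _ (by exact_mod_cast hd.ne')
  obtain ⟨δ, hδ⟩ := Int.gcd_dvd_right (d : ℤ) (valDeg v u)
  obtain ⟨n, hn⟩ : Int.gcd d (valDeg v u) ∣ d := by
    have := Int.gcd_dvd_left (d : ℤ) (valDeg v u)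
    exact_mod_cast this
  set g := Int.gcd d (valDeg v u) with hgdef
  have hn0 : 0 < n := by
    rcases Nat.eq_zero_or_pos n with h | h
    · rw [h, mul_zero] at hn; omega
    · exact h
  have hcop : IsCoprime (n : ℤ) δ := by
    have h1 := Int.gcd_eq_gcd_ab d (valDeg v u)
    rw [← hgdef] at h1
    refine ⟨Int.gcdA d (valDeg v u), Int.gcdB d (valDeg v u), ?_⟩
    have hg' : (g : ℤ) ≠ 0 := by exact_mod_cast hg.ne'
    apply mul_left_cancel₀ hg'
    have hn' : (d : ℤ) = g * n := by exact_mod_cast hn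
    have h2 : (g : ℤ) = g * n * Int.gcdA d (valDeg v u) + g * δ * Int.gcdB d (valDeg v u) := by
      rw [← hn', ← hδ]; exact h1
    linear_combination -h2
  obtain ⟨Q, hQ, PQ, hPQ, haQ, hvQ⟩ := S.exists_poly δ
  refine ⟨n, g, δ, Q, Q⁻¹ * u ^ n, PQ, hn0, hg, by rw [mul_comm]; exact hn, hδ, hcop, hQ, hPQ, haQ,
    hvQ, by simp, ?_⟩
  rw [valDeg_mul, valDeg_inv, hvQ, valDeg_pow]
  have hn' : (d : ℤ) = g * n := by exact_mod_cast hn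
  rw [hδ, hn']
  ring

theorem dvd_of_dvd_mul_degree {n d d' : ℕ} (hd' : 0 < d') {δ e : ℤ} (hd : d = n * d')
    (he : e = d' * δ) (hcop : IsCoprime (n : ℤ) δ) (j : ℤ) (h : (d : ℤ) ∣ j * e) :
    (n : ℤ) ∣ j := by
  refine hcop.dvd_of_dvd_mul_right (?_ : (n : ℤ) ∣ j * δ)
  have hd0 : (d' : ℤ) ≠ 0 := by exact_mod_cast hd'.ne'
  refine Int.dvd_of_mul_dvd_mul_left hd0 ?_
  rw [hd, he] at h
  push_cast at h
  have e1 : (d' : ℤ) * n = n * d' := mul_comm _ _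
  have e2 : (d' : ℤ) * (j * δ) = j * (d' * δ) := by ring
  rwa [e1, e2]

/-- If the relevant polynomials in `T` have degree zero, nothing cancels at the top, so `P(G)` has
degree at least that of its last term `c_N(G) * u ^ N`. This serves both when the residue of `T` is
transcendental and when `deg P` is too small for `T` to occur. -/
theorem IsKeyStage.aeval_low_of_residue
    (hk : ∀ c : k, c ≠ 0 → v (algebraMap k K c) = 1)
    (S : IsKeyStage v D₁ D₂ E G M u U d ω) (hu : 2 ≤ valDeg v u) {n : ℕ}
    (hdvd : ∀ j : ℤ, (d : ℤ) ∣ j * valDeg v u → (n : ℤ) ∣ j) {Q T : Kˣ} (hQ : Q ∈ M)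
    (hT : u ^ n = Q * T) (hT0 : valDeg v T = 0) (P : E[X]) (hP : P ≠ 0)
    (hTP : ∀ p : k[X], p ≠ 0 → p.natDegree * (n * U.natDegree) ≤ P.natDegree → v (aeval (T : K) p) = 1)
    (hlead : 1 ≤ v (P.leadingCoeff : K)) :
    1 ≤ v (aeval G P) ∧ (0 < P.natDegree → exp (2 : ℤ) ≤ v (aeval G P)) := by
  obtain ⟨N, c, hc, hN, hsum, hl, hdeg⟩ := exists_adic_expansion S.monic S.natDegree_pos P hP
  obtain ⟨m, hm, j₀, p, hp, hpdeg, htop, hle⟩ := S.expansion_top hk hdvd hQ hT hT0 hc hN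
  have hvp : v (aeval (T : K) p) = 1 := by
    refine hTP p hp ?_
    have : p.natDegree * n ≤ N := (Nat.mul_le_mul_right n hpdeg).trans (Nat.div_mul_le_self N n)
    rw [← mul_assoc, hdeg]
    exact (Nat.mul_le_mul_right _ this).trans (Nat.le_add_left _ _)
  have hB : v ((m * u ^ j₀ : Kˣ) * aeval (T : K) p) = v (m * u ^ j₀ : Kˣ) := by
    rw [map_mul, hvp, mul_one]
  rw [← hsum, ← hB] at htop
  have hPv := v.map_eq_of_sub_lt htop
  rw [hB] at hPv
  rw [hPv]
  rw [← hl] at hlead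
  have h1 := S.one_le _ hN (hc N) hlead
  have hu1 : exp (2 : ℤ) ≤ v u := by rwa [val_eq_exp_valDeg, WithZero.exp_le_exp]
  have h12 : (1 : ℤᵐ⁰) ≤ exp (2 : ℤ) := by
    rw [← WithZero.exp_zero, WithZero.exp_le_exp]; norm_num
  refine ⟨(one_le_mul h1 (one_le_pow₀ (h12.trans hu1))).trans hle, fun hpos => ?_⟩
  -- For `N = 0` the nonconstant polynomial is `c 0` itself, covered by the stage; for `N > 0` a
  -- single factor `u` already has degree 2.
  rcases Nat.eq_zero_or_pos N with h0 | h0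
  · subst h0
    rw [pow_zero, mul_one] at hle
    exact (S.two_le _ hN (hc 0) hlead (by omega)).trans hle
  · refine le_trans ?_ hle
    calc exp (2 : ℤ) = 1 * exp (2 : ℤ) := (one_mul _).symm
      _ ≤ v (aeval G (c N)) * v u ^ N :=
        mul_le_mul' h1 (hu1.trans (le_self_pow₀ (h12.trans hu1) h0.ne'))

/-- The bracket is additive in each argument. With `T = u ^ n / Q`, the brackets with `u` contribute
`n * r * ω` from `m` and `q * δ * ω` from `Q`, whose degree is `d * δ`; the bracket of `m` and `Q`
is negligible. -/
theorem IsKeyStage.val_br_quotient (hk : ∀ c : k, c ≠ 0 → v (algebraMap k K c) = 1)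
    (S : IsKeyStage v D₁ D₂ E G M u U d ω) {n d' : ℕ} {δ : ℤ} {Q T : Kˣ} (hd' : 0 < d')
    (hd : d = n * d') (hu : valDeg v u = d' * δ) (hQ : Q ∈ M) (hvQ : valDeg v Q = d * δ)
    (hT : u ^ n = Q * T) {m : Kˣ} (hm : m ∈ M) (q r' : ℤ) (h : valDeg v (m * u ^ q) = d' * r') :
    v (logBr D₁ D₂ (m * u ^ q) T - r' * ω) < v ω := by
  obtain ⟨r, hr⟩ := S.dvd_valDeg m hm
  have hr' : r' = n * r + q * δ := by
    have hd0 : (d' : ℤ) ≠ 0 := by exact_mod_cast hd'.ne'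
    apply mul_left_cancel₀ hd0
    rw [← h, valDeg_mul, valDeg_zpow, hr, hu, hd]
    push_cast
    ring
  have hT' : T = u ^ n * Q⁻¹ := by rw [hT]; simp
  have e : logBr D₁ D₂ (m * u ^ q) T - r' * ω =
      (n : ℤ) * (logBr D₁ D₂ m u - r * ω) - logBr D₁ D₂ m Q +
        q * (logBr D₁ D₂ Q u - δ * ω) := by
    rw [hT', hr', logBr_mul_left, logBr_zpow_left, logBr_mul_right, logBr_mul_right,
      logBr_pow_right, logBr_pow_right, logBr_inv_right, logBr_inv_right, logBr_self,
      logBr_swap D₁ D₂ Q u]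
    push_cast
    ring
  rw [e]
  refine v.map_add_lt (v.map_sub_lt ?_ (S.br_mem m hm Q hQ)) ?_
  · exact (val_intCast_mul_le v hk _ _).trans_lt (S.br_key m hm r hr)
  · exact (val_intCast_mul_le v hk _ _).trans_lt (S.br_key Q hQ δ hvQ)

theorem mem_sup_zpowers {M : Subgroup Kˣ} {u x : Kˣ} :
    x ∈ M ⊔ Subgroup.zpowers u ↔ ∃ m ∈ M, ∃ q : ℤ, x = m * u ^ q := by
  rw [Subgroup.mem_sup]
  constructor
  · rintro ⟨m, hm, _, ⟨q, rfl⟩, rfl⟩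
    exact ⟨m, hm, q, rfl⟩
  · rintro ⟨m, hm, q, rfl⟩
    exact ⟨m, hm, u ^ q, ⟨q, rfl⟩, rfl⟩

/-- When `T` has constant residue `μ`, the leading terms of `U ^ n` and `μ * PQ` cancel at `G`, so
their difference is the new key polynomial, with value `Q * (T - μ)`. Replacing `T` by `T - μ`
leaves its derivatives unchanged but divides by a smaller element, so brackets grow by the factor `T
/ (T - μ)`: the degree lost by the key value is gained by `ω`. -/
theorem IsKeyStage.next (hk : ∀ c : k, c ≠ 0 → v (algebraMap k K c) = 1)
    (S : IsKeyStage v D₁ D₂ E G M u U d ω) (hu2 : 2 ≤ valDeg v u) {n d' : ℕ} {δ : ℤ} {Q T : Kˣ}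
    {PQ : E[X]} (hn : 0 < n) (hd' : 0 < d') (hd : d = n * d') (hu : valDeg v u = d' * δ)
    (hcop : IsCoprime (n : ℤ) δ) (hQ : Q ∈ M) (hPQ : PQ.degree < U.degree)
    (haQ : aeval G PQ = (Q : K)) (hvQ : valDeg v Q = d * δ)
    (hT : u ^ n = Q * T) (hT0 : valDeg v T = 0) {μ : k}
    (hμ : v ((T : K) - algebraMap k K μ) < 1) :
    ∃ (e : ℤ) (u' : Kˣ) (U' : E[X]) (ω' : K), 0 < e ∧ v ω' = exp e * v ω ∧
      valDeg v u' = n * valDeg v u - e ∧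
      IsKeyStage v D₁ D₂ E G (M ⊔ Subgroup.zpowers u) u' U' d' ω' := by
  have hdvd := dvd_of_dvd_mul_degree hd' hd hu hcop
  obtain ⟨a, b, hab⟩ := hcop
  -- A constant `T` would have bracket zero with everything, but the Bezout relation gives a
  -- monomial of degree exactly `d'`, whose bracket with `T` has the size of `ω`.
  have hne : (T : K) - algebraMap k K μ ≠ 0 := by
    intro h0
    obtain ⟨m, hm, -, -, -, hvm⟩ := S.exists_poly a
    have h1 := S.val_br_quotient hk hd' hd hu hQ hvQ hT hm b 1 (by
      rw [valDeg_mul, valDeg_zpow, hvm, hu, hd]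
      push_cast
      linear_combination (d' : ℤ) * hab)
    rw [logBr_of_eq_const D₁ D₂ _ T μ (sub_eq_zero.1 h0), zero_sub, Valuation.map_neg,
      Int.cast_one, one_mul] at h1
    exact lt_irrefl _ h1
  obtain ⟨T', hT'⟩ : ∃ T' : Kˣ, (T' : K) = T - algebraMap k K μ := ⟨Units.mk0 _ hne, rfl⟩
  rw [← hT', val_eq_exp_valDeg, ← WithZero.exp_zero, WithZero.exp_lt_exp] at hμ
  have hvω : v ((T / T' : Kˣ) * ω) = exp (-valDeg v T') * v ω := by
    rw [map_mul, val_eq_exp_valDeg, valDeg_div, hT0, zero_sub]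
  have hωlt : v ω < v ((T / T' : Kˣ) * ω) := by
    rw [hvω]
    refine lt_mul_of_one_lt_left ?_ ?_
    · rw [zero_lt_iff, v.ne_zero_iff]; exact S.ne_zero
    · rw [← WithZero.exp_zero, WithZero.exp_lt_exp]; omega
  have hbrQ : ∀ m ∈ M, ∀ q : ℤ, v (logBr D₁ D₂ (m * u ^ q) Q) ≤ v ω := by
    intro m hm q
    rw [logBr_mul_left, logBr_zpow_left, logBr_swap D₁ D₂ Q u]
    refine v.map_add_le (S.br_mem m hm Q hQ).le ((val_intCast_mul_le v hk _ _).trans ?_)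
    rw [Valuation.map_neg]
    exact S.val_br_le hk hQ
  have hUn : (U ^ n).Monic := S.monic.pow n
  have hPQ' : (C (algebraMap k E μ) * PQ).degree < (U ^ n).degree := by
    rw [← smul_eq_C_mul]
    refine (degree_smul_le _ _).trans_lt (hPQ.trans_le ?_)
    rw [degree_pow, nsmul_eq_mul]
    rw [degree_eq_natDegree S.monic.ne_zero]
    norm_cast
    exact Nat.le_mul_of_pos_left _ hn
  have hU'deg : (U ^ n - C (algebraMap k E μ) * PQ).natDegree = n * U.natDegree := by
    rw [natDegree_sub_eq_left_of_natDegree_lt, natDegree_pow]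
    by_cases h0 : C (algebraMap k E μ) * PQ = 0
    · rw [h0, natDegree_zero, natDegree_pow]
      exact Nat.mul_pos hn S.natDegree_pos
    · exact natDegree_lt_natDegree h0 hPQ'
  have hexp : ∀ P : E[X], P ≠ 0 → P.degree < (U ^ n - C (algebraMap k E μ) * PQ).degree →
      ∀ N, N * U.natDegree ≤ P.natDegree → N < n := by
    intro P hP0 hP N hN
    have := natDegree_lt_natDegree hP0 hP
    rw [hU'deg] at this
    exact Nat.lt_of_mul_lt_mul_right (hN.trans_lt this)
  have hlow : ∀ P : E[X], P ≠ 0 → P.degree < (U ^ n - C (algebraMap k E μ) * PQ).degree →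
      1 ≤ v (P.leadingCoeff : K) →
      1 ≤ v (aeval G P) ∧ (0 < P.natDegree → exp (2 : ℤ) ≤ v (aeval G P)) := by
    intro P hP0 hP hlead
    refine S.aeval_low_of_residue hk hu2 hdvd hQ hT hT0 P hP0 (fun p hp hpdeg => ?_) hlead
    have h1 := natDegree_lt_natDegree hP0 hP
    rw [hU'deg] at h1
    -- Below degree `n * deg U` no full power `U ^ n` occurs, so `p` is constant and the residue of
    -- `T` is irrelevant.
    have h2 : p.natDegree = 0 := by
      by_contra h
      exact absurd (hpdeg.trans_lt h1) (not_lt.2 (Nat.le_mul_of_pos_left _ (Nat.pos_of_ne_zero h)))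
    rw [eq_C_of_natDegree_eq_zero h2] at hp ⊢
    rw [aeval_C]
    exact hk _ (by simpa using hp)
  refine ⟨-valDeg v T', Q * T', U ^ n - C (algebraMap k E μ) * PQ, (T / T' : Kˣ) * ω, by omega, hvω,
    ?_, ?_⟩
  · rw [valDeg_mul, hvQ, hu, hd]
    push_cast
    ring
  refine ⟨hUn.sub_of_left hPQ', ?_, ?_, hd', ?_, ?_, ?_, ?_, fun P h0 h1 h2 => (hlow P h0 h1 h2).1,
    fun P h0 h1 h2 => (hlow P h0 h1 h2).2, mul_ne_zero (Units.ne_zero _) S.ne_zero, ?_, ?_⟩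
  · rw [hU'deg]
    exact Nat.mul_pos hn S.natDegree_pos
  · have : (u : K) ^ n = Q * T := by exact_mod_cast congrArg Units.val hT
    rw [map_sub, map_pow, S.aeval_eq, map_mul, aeval_C, haQ, this, Units.val_mul, hT']
    change (Q : K) * T - algebraMap k K μ * Q = _
    ring
  · intro x hx
    obtain ⟨m, hm, q, rfl⟩ := mem_sup_zpowers.1 hx
    rw [valDeg_mul, valDeg_zpow, hu]
    refine dvd_add ?_ (Dvd.intro (q * δ) (by ring))
    refine dvd_trans ?_ (S.dvd_valDeg m hm)
    rw [hd]
    push_cast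
    exact dvd_mul_left _ _
  · intro r
    have hn' : (0 : ℤ) < n := by exact_mod_cast hn
    obtain ⟨j, hj⟩ := Int.eq_ofNat_of_zero_le (Int.emod_nonneg (b * r) hn'.ne')
    have hjlt : j < n := by
      have := Int.emod_lt_of_pos (b * r) hn'
      rw [hj] at this
      exact_mod_cast this
    have hdm := Int.emod_add_mul_ediv (b * r) n
    rw [hj] at hdm
    -- From `a * n + b * δ = 1`: the exponent `b * r` of `u` is reduced mod `n` to keep the
    -- polynomial below degree `n * deg U`, and the quotient is absorbed into `M` as a multiple of
    -- `δ`.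
    obtain ⟨m, hm, P, hP, haP, hvm⟩ := S.exists_poly (r * a + (b * r / n) * δ)
    have hP0 : P ≠ 0 := by
      rintro rfl
      rw [map_zero] at haP
      exact m.ne_zero haP.symm
    refine ⟨m * u ^ j, mem_sup_zpowers.2 ⟨m, hm, j, by simp⟩, P * U ^ j, ?_, ?_, ?_⟩
    · refine degree_lt_degree ?_
      rw [hU'deg, natDegree_mul hP0 (pow_ne_zero _ S.monic.ne_zero), natDegree_pow]
      have h1 := natDegree_lt_natDegree hP0 hP
      calc P.natDegree + j * U.natDegree < (j + 1) * U.natDegree := by rw [add_mul]; omega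
        _ ≤ n * U.natDegree := Nat.mul_le_mul_right _ hjlt
    · rw [map_mul, map_pow, haP, S.aeval_eq]
      push_cast
      rfl
    · rw [valDeg_mul, valDeg_pow, hvm, hu, hd]
      push_cast
      have hdm' : (j : ℤ) + n * (b * r / n) = b * r := hdm
      linear_combination (d' : ℤ) * r * hab + (d' : ℤ) * δ * hdm'
  · intro x hx hx0
    obtain ⟨m, hm, q, rfl⟩ := mem_sup_zpowers.1 hx
    rw [valDeg_mul, valDeg_zpow] at hx0
    obtain ⟨l, rfl⟩ := hdvd q (by
      have : q * valDeg v u = - valDeg v m := by linarith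
      rw [this]
      exact (S.dvd_valDeg m hm).neg_right)
    -- A monomial of degree zero involves `u` only through `u ^ n = Q * T`, and `T` has constant
    -- residue.
    have e : m * u ^ ((n : ℤ) * l) = (m * Q ^ l) * T ^ l := by
      rw [zpow_mul, zpow_natCast, hT, mul_zpow, mul_assoc]
    have hmQ : m * Q ^ l ∈ M := M.mul_mem hm (M.zpow_mem hQ l)
    have hmQ0 : valDeg v (m * Q ^ l) = 0 := by
      rw [valDeg_mul, valDeg_zpow, hvQ, ← hx0, hu, hd]
      push_cast
      ring
    obtain ⟨c, hc⟩ := S.residue _ hmQ hmQ0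
    have hTres : T ∈ residueConst v hk := mem_residueConst_of_val_eq_one hT0 (c := μ) (by
      rw [← hT', val_eq_exp_valDeg, ← WithZero.exp_zero, WithZero.exp_lt_exp]
      exact hμ)
    have := (residueConst v hk).mul_mem (mem_residueConst_of_val_eq_one hmQ0 hc)
      ((residueConst v hk).zpow_mem hTres l)
    rw [← e] at this
    obtain ⟨c', -, h⟩ := this
    exact ⟨c', h⟩
  · intro P hP0 hP
    obtain ⟨N, c, hc, hN, hsum, hl, hdeg⟩ := exists_adic_expansion S.monic S.natDegree_pos P hP0
    obtain ⟨m, hm, j₀, p, hp, hpdeg, htop, hle⟩ := S.expansion_top hk hdvd hQ hT hT0 hc hN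
    have hNn := hexp P hP0 hP N (by omega)
    rw [Nat.div_eq_of_lt hNn, Nat.le_zero] at hpdeg
    rw [eq_C_of_natDegree_eq_zero hpdeg] at htop hp
    rw [← hsum, aeval_C, mul_comm] at htop
    exact ⟨m * u ^ j₀, mem_sup_zpowers.2 ⟨m, hm, j₀, by simp⟩, p.coeff 0, by simpa using hp, htop⟩
  · intro x hx y hy
    obtain ⟨m, hm, q, rfl⟩ := mem_sup_zpowers.1 hx
    obtain ⟨m', hm', q', rfl⟩ := mem_sup_zpowers.1 hy
    refine lt_of_le_of_lt ?_ hωlt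
    simp only [logBr_mul_left, logBr_mul_right, logBr_zpow_left, logBr_zpow_right, logBr_self,
      mul_zero, add_zero]
    refine v.map_add_le (v.map_add_le (S.br_mem m hm m' hm').le ?_) ?_
    · rw [logBr_swap D₁ D₂ m' u]
      refine (val_intCast_mul_le v hk _ _).trans ?_
      rw [Valuation.map_neg]
      exact S.val_br_le hk hm'
    · exact (val_intCast_mul_le v hk _ _).trans (S.val_br_le hk hm)
  · intro x hx r hr
    obtain ⟨m, hm, q, rfl⟩ := mem_sup_zpowers.1 hx
    have h1 := S.val_br_quotient hk hd' hd hu hQ hvQ hT hm q r hr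
    have h2 := mul_logBr_of_sub_const D₁ D₂ (m * u ^ q) T T' μ hT'
    have hT'0 := T'.ne_zero
    have e : logBr D₁ D₂ (m * u ^ q) (Q * T') - r * ((T / T' : Kˣ) * ω) =
        logBr D₁ D₂ (m * u ^ q) Q + (T / T' : Kˣ) * (logBr D₁ D₂ (m * u ^ q) T - r * ω) := by
      rw [logBr_mul_right, ← sub_eq_zero]
      push_cast
      field_simp
      linear_combination h2
    rw [e]
    refine v.map_add_lt ((hbrQ m hm q).trans_lt hωlt) ?_
    rw [map_mul, map_mul]
    exact mul_lt_mul_of_pos_left h1 (by rw [zero_lt_iff]; exact v.ne_zero_of_unit _)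

/-- In a stage whose bracket is not too small, every nonconstant polynomial in `G` with a leading
coefficient of nonnegative degree has degree at least two. -/
theorem IsKeyStage.two_le_aeval (hk : ∀ c : k, c ≠ 0 → v (algebraMap k K c) = 1)
    (hres : ∀ T : Kˣ, valDeg v T = 0 → (∃ μ : k, v ((T : K) - algebraMap k K μ) < 1) ∨
      ∀ p : k[X], p ≠ 0 → v (aeval (T : K) p) = 1)
    (hbr : ∀ x y : Kˣ, v (logBr D₁ D₂ x y) ≤ exp (-2 : ℤ))
    (P : E[X]) (hP : P ≠ 0) (hlead : 1 ≤ v (P.leadingCoeff : K)) (hpos : 0 < P.natDegree) (t : ℕ)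
    (M : Subgroup Kˣ) (u : Kˣ) (U : E[X]) (d : ℕ) (ω : K)
    (S : IsKeyStage v D₁ D₂ E G M u U d ω) {κ : ℤ} (hω : v ω = exp κ)
    (hκ : 0 ≤ κ + valDeg v u) (ht : -κ ≤ t) : exp (2 : ℤ) ≤ v (aeval G P) := by
  induction t generalizing M u U d ω κ with
  -- Here `κ ≥ 0`, while an element of `M` of degree `d` has bracket with `u` of degree `κ`, which
  -- is at most `-2`.
  | zero =>
    exfalso
    obtain ⟨m, hm, -, -, -, hvm⟩ := S.exists_poly 1
    have h1 := S.br_key m hm 1 hvm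
    rw [Int.cast_one, one_mul] at h1
    have h2 := hbr m u
    rw [v.map_eq_of_sub_lt h1, hω, WithZero.exp_le_exp] at h2
    push_cast at ht
    omega
  | succ t ih =>
    obtain ⟨m, hm, -, -, -, hvm⟩ := S.exists_poly 1
    have h1 := S.br_key m hm 1 hvm
    rw [Int.cast_one, one_mul] at h1
    have h2 := hbr m u
    rw [v.map_eq_of_sub_lt h1, hω, WithZero.exp_le_exp] at h2
    obtain ⟨n, d', δ, Q, T, PQ, hn, hd', hd, hu, hcop, hQ, hPQ, haQ, hvQ, hT, hT0⟩ :=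
      S.exists_quotient
    -- The bound `κ ≤ -2` and the invariant `κ + deg u ≥ 0` give `deg u ≥ 2`. The next stage has sum
    -- `κ + n * deg u`, so the invariant persists while `κ` strictly increases.
    rcases hres T hT0 with ⟨μ, hμ⟩ | htr
    · obtain ⟨e, u', U', ω', he, hω', hu', S'⟩ :=
        S.next hk (by omega) hn hd' hd hu hcop hQ hPQ haQ hvQ hT hT0 hμ
      refine ih _ u' U' d' ω' S' (κ := e + κ) (by rw [hω', hω, WithZero.exp_add]) ?_ ?_
      · have h3 : valDeg v u ≤ n * valDeg v u := by
          have : (1 : ℤ) ≤ n := by exact_mod_cast hn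
          nlinarith
        omega
      · push_cast at ht
        omega
    · exact (S.aeval_low_of_residue hk (by omega) (dvd_of_dvd_mul_degree hd' hd hu hcop) hQ hT
        hT0 P hP (fun p hp _ => htr p hp) hlead).2 hpos

end Step

end PolyAut

end

noncomputable section

namespace PolyAut

open scoped WithZero
open WithZero (exp log)

/-! ### The degree reduction for a pair `F`, `G` -/

section Reduction

open Polynomial IntermediateField

variable {k K : Type*} [Field k] [Field K] [Algebra k K] {v : Valuation K ℤᵐ⁰}
  {D₁ D₂ : Derivation k K K}

theorem val_aeval_sub_lt (hk : ∀ c : k, c ≠ 0 → v (algebraMap k K c) = 1) {F : Kˣ}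
    (hF : 0 < valDeg v F) (p : k[X]) :
    v (aeval (F : K) p - algebraMap k K p.leadingCoeff * (F : K) ^ p.natDegree) <
      v ((F : K) ^ p.natDegree) := by
  have hle : ∀ c : k, v (algebraMap k K c) ≤ 1 := fun c => by
    by_cases h : c = 0
    · simp [h]
    · exact (hk c h).le
  have h1 : (1 : ℤᵐ⁰) < v F := by
    rw [val_eq_exp_valDeg, ← WithZero.exp_zero, WithZero.exp_lt_exp]
    exact hF
  rw [aeval_eq_sum_range, Finset.sum_range_succ, ← Algebra.smul_def, leadingCoeff,
    add_sub_cancel_right]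
  refine v.map_sum_lt ?_ fun i hi => ?_
  · rw [v.ne_zero_iff]
    exact pow_ne_zero _ F.ne_zero
  · rw [Algebra.smul_def, map_mul, map_pow, map_pow]
    refine (mul_le_of_le_one_left' (hle _)).trans_lt ?_
    exact pow_lt_pow_right₀ h1 (Finset.mem_range.1 hi)

/-- A polynomial in `F` is dominated by its highest power because `deg F > 0`; quotients inherit
this. -/
theorem exists_zpow_of_mem_adjoin (hk : ∀ c : k, c ≠ 0 → v (algebraMap k K c) = 1) {F : Kˣ}
    (hF : 0 < valDeg v F) {x : K} (hx : x ∈ k⟮(F : K)⟯) (hx0 : x ≠ 0) :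
    ∃ (a : ℤ) (c : k), c ≠ 0 ∧ v (x - algebraMap k K c * (F ^ a : Kˣ)) < v (F ^ a : Kˣ) := by
  obtain ⟨r, s, rfl⟩ := (IntermediateField.mem_adjoin_simple_iff k x).1 hx
  obtain ⟨hr, hs⟩ := div_ne_zero_iff.1 hx0
  have key : ∀ p : k[X], ∀ hp : aeval (F : K) p ≠ 0,
      Units.mk0 _ hp / F ^ p.natDegree ∈ residueConst v hk := by
    intro p hp
    refine ⟨p.leadingCoeff, ?_, ?_⟩
    · rw [Ne, leadingCoeff_eq_zero]
      rintro rfl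
      simp at hp
    · have hF0 := pow_ne_zero p.natDegree F.ne_zero
      have h := val_aeval_sub_lt hk hF p
      have e : ((Units.mk0 _ hp / F ^ p.natDegree : Kˣ) : K) - algebraMap k K p.leadingCoeff =
          (aeval (F : K) p - algebraMap k K p.leadingCoeff * (F : K) ^ p.natDegree) /
            (F : K) ^ p.natDegree := by
        push_cast
        rw [Units.val_mk0]
        field_simp
      rw [e, map_div₀]
      exact (div_lt_one₀ (by rw [zero_lt_iff, v.ne_zero_iff]; exact hF0)).2 h
  obtain ⟨c, hc, h⟩ := (residueConst v hk).div_mem (key r hr) (key s hs)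
  refine ⟨r.natDegree - s.natDegree, c, hc, ?_⟩
  have hF0 := F.ne_zero
  have e : aeval (F : K) r / aeval (F : K) s -
      algebraMap k K c * (F ^ ((r.natDegree : ℤ) - s.natDegree) : Kˣ) =
      (F ^ ((r.natDegree : ℤ) - s.natDegree) : Kˣ) *
        (((Units.mk0 _ hr / F ^ r.natDegree / (Units.mk0 _ hs / F ^ s.natDegree) : Kˣ) : K) -
          algebraMap k K c) := by
    push_cast
    rw [zpow_sub₀ hF0, zpow_natCast, zpow_natCast, Units.val_mk0, Units.val_mk0]
    field_simp
  rw [e, map_mul]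
  exact mul_lt_of_lt_one_right (by rw [zero_lt_iff]; exact v.ne_zero_of_unit _) h

theorem IsKeyStage.init (hk : ∀ c : k, c ≠ 0 → v (algebraMap k K c) = 1) {F G : Kˣ} {d : ℕ}
    (hd : 0 < d) (hF : valDeg v F = d) (hω : logBr D₁ D₂ F G ≠ 0) :
    IsKeyStage v D₁ D₂ k⟮(F : K)⟯ (G : K) (Subgroup.zpowers F) G X d (logBr D₁ D₂ F G) where
  monic := monic_X
  natDegree_pos := by simp
  aeval_eq := by simp
  d_pos := hd
  dvd_valDeg := by
    rintro _ ⟨a, rfl⟩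
    simp only [valDeg_zpow, hF]
    exact dvd_mul_left _ _
  exists_poly r := by
    refine ⟨F ^ r, ⟨r, rfl⟩, C ⟨(F ^ r : Kˣ), ?_⟩, ?_, ?_, ?_⟩
    · rw [Units.val_zpow_eq_zpow_val]
      exact zpow_mem (IntermediateField.mem_adjoin_simple_self k (F : K)) r
    · rw [degree_X]
      exact degree_C_lt.trans_le (by norm_num)
    · rw [aeval_C]
      rfl
    · rw [valDeg_zpow, hF, mul_comm]
  residue := by
    rintro _ ⟨a, rfl⟩ h
    have h' : valDeg v (F ^ a) = 0 := h
    rw [valDeg_zpow, hF, mul_eq_zero] at h'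
    have ha : a = 0 := h'.resolve_right (by exact_mod_cast hd.ne')
    exact ⟨1, by simp [ha]⟩
  top P hP hdeg := by
    rw [degree_X, ← Nat.cast_one, ← natDegree_lt_iff_degree_lt hP, Nat.lt_one_iff] at hdeg
    rw [eq_C_of_natDegree_eq_zero hdeg] at hP ⊢
    obtain ⟨a, c, hc, h⟩ := exists_zpow_of_mem_adjoin hk (by rw [hF]; exact_mod_cast hd)
      (P.coeff 0).2 (by simpa using hP)
    refine ⟨F ^ a, ⟨a, rfl⟩, c, hc, ?_⟩
    rw [aeval_C]
    exact h
  one_le P hP hdeg hlead := by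
    rw [degree_X, ← Nat.cast_one, ← natDegree_lt_iff_degree_lt hP, Nat.lt_one_iff] at hdeg
    rw [eq_C_of_natDegree_eq_zero hdeg] at hlead ⊢
    rw [leadingCoeff_C] at hlead
    rw [aeval_C]
    exact hlead
  two_le P hP hdeg hlead hpos := by
    rw [degree_X, ← Nat.cast_one, ← natDegree_lt_iff_degree_lt hP, Nat.lt_one_iff] at hdeg
    omega
  ne_zero := hω
  br_mem := by
    rintro _ ⟨a, rfl⟩ _ ⟨b, rfl⟩
    simp only [logBr_zpow_left, logBr_zpow_right, logBr_self, mul_zero, map_zero]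
    rw [zero_lt_iff, v.ne_zero_iff]
    exact hω
  br_key := by
    rintro _ ⟨a, rfl⟩ r h
    have h' : valDeg v (F ^ a) = d * r := h
    rw [valDeg_zpow, hF, mul_comm] at h'
    have : a = r := mul_left_cancel₀ (by exact_mod_cast hd.ne') h'
    simp only [this, logBr_zpow_left, sub_self, map_zero]
    rw [zero_lt_iff, v.ne_zero_iff]
    exact hω

/-- The reduction step: if `x` and `y` are independent elements of degree one that are polynomials
in `F` and `G`, and the bracket of `F` and `G` has the maximal possible size, then the degree of
`G` can be lowered by subtracting a multiple of a power of `F`. -/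
theorem exists_reduction (hk : ∀ c : k, c ≠ 0 → v (algebraMap k K c) = 1)
    (hres : ∀ T : Kˣ, valDeg v T = 0 → (∃ μ : k, v ((T : K) - algebraMap k K μ) < 1) ∨
      ∀ p : k[X], p ≠ 0 → v (aeval (T : K) p) = 1)
    (hbr : ∀ x y : Kˣ, v (logBr D₁ D₂ x y) ≤ exp (-2 : ℤ)) {F G : Kˣ} (hF : 0 < valDeg v F)
    (hFG : valDeg v F ≤ valDeg v G) (hG : 2 ≤ valDeg v G)
    (hω : v (logBr D₁ D₂ F G) = exp (-valDeg v F - valDeg v G)) {x y : K}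
    (hy : v y = exp (1 : ℤ))
    (hxy : ∀ μ : k, v (x - algebraMap k K μ * y) = exp (1 : ℤ))
    (hpoly : ∀ z ∈ ({x, y} : Set K), ∃ P : k⟮(F : K)⟯[X], aeval (G : K) P = z ∧
      (P ≠ 0 → 1 ≤ v (P.leadingCoeff : K))) :
    ∃ (a : ℕ) (μ : k), v ((G : K) - algebraMap k K μ * (F : K) ^ a) < v G := by
  by_contra hcon
  have hx : v x = exp (1 : ℤ) := by simpa using hxy 0
  obtain ⟨d, hd⟩ := Int.eq_ofNat_of_zero_le hF.le
  have hd0 : 0 < d := by rw [hd] at hF; exact_mod_cast hF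
  have hω0 : logBr D₁ D₂ F G ≠ 0 := by
    rw [← v.ne_zero_iff, hω]
    exact WithZero.exp_ne_zero
  have S := IsKeyStage.init hk hd0 hd hω0
  -- If everything involving `G` had degree at least 2, then `x` and `y` would lie in `k(F)`. Being
  -- of degree one, they would have leading terms proportional to the same power of `F`, against
  -- `hxy`.
  have main : ¬ ∀ P : k⟮(F : K)⟯[X], P ≠ 0 → 1 ≤ v (P.leadingCoeff : K) → 0 < P.natDegree →
      exp (2 : ℤ) ≤ v (aeval (G : K) P) := by
    intro hlow
    have hmem : ∀ z ∈ ({x, y} : Set K), v z = exp (1 : ℤ) →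
        ∃ (a : ℤ) (c : k), c ≠ 0 ∧ v (z - algebraMap k K c * (F ^ a : Kˣ)) < v (F ^ a : Kˣ) := by
      intro z hz hvz
      obtain ⟨P, rfl, hP⟩ := hpoly z hz
      have hz0 : aeval (G : K) P ≠ 0 := by
        rw [← v.ne_zero_iff, hvz]
        exact WithZero.exp_ne_zero
      have hP0 : P ≠ 0 := by
        rintro rfl
        simp at hz0
      have hdeg : P.natDegree = 0 := by
        by_contra h
        have := hlow P hP0 (hP hP0) (Nat.pos_of_ne_zero h)
        rw [hvz, WithZero.exp_le_exp] at this
        norm_num at this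
      rw [eq_C_of_natDegree_eq_zero hdeg, aeval_C] at hz0 ⊢
      exact exists_zpow_of_mem_adjoin hk hF (P.coeff 0).2 hz0
    obtain ⟨a, c, hc, h⟩ := hmem x (by simp) hx
    obtain ⟨b, c', hc', h'⟩ := hmem y (by simp) hy
    have e1 := val_eq_of_val_sub_const_mul_lt hk hc h
    have e2 := val_eq_of_val_sub_const_mul_lt hk hc' h'
    rw [hx] at e1
    rw [hy] at e2
    have hab : a = b := by
      have h1 := (valDeg_eq_iff v).2 e1.symm
      have h2 := (valDeg_eq_iff v).2 e2.symm
      rw [valDeg_zpow] at h1 h2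
      exact mul_right_cancel₀ hF.ne' (h1.trans h2.symm)
    subst hab
    have h3 := hxy (c / c')
    have h4 : algebraMap k K c' ≠ 0 := by simpa using hc'
    have e : x - algebraMap k K (c / c') * y = (x - algebraMap k K c * (F ^ a : Kˣ)) -
        algebraMap k K (c / c') * (y - algebraMap k K c' * (F ^ a : Kˣ)) := by
      rw [map_div₀]
      field_simp
      ring
    rw [e, e1] at h3
    refine absurd h3 (ne_of_lt (v.map_sub_lt h ?_))
    rw [map_mul, hk _ (div_ne_zero hc hc'), one_mul]
    exact h'
  obtain ⟨n, d', δ, Q, T, PQ, hn, hd', hdn, hu, hcop, hQ, hPQ, haQ, hvQ, hT, hT0⟩ :=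
    S.exists_quotient
  rcases hres T hT0 with ⟨μ, hμ⟩ | htr
  -- At the initial stage `κ + deg G = -deg F` is negative. For `n ≥ 2` one step turns this sum into
  -- `n * deg G - deg F - deg G ≥ 0`, and the general argument applies. For `n = 1` the constant
  -- residue says that `G` agrees to leading order with `μ * F ^ a`, which is the reduction sought.
  · rcases Nat.lt_or_ge 1 n with hn1 | hn1
    · obtain ⟨e, u', U', ω', he, hω', hu', S'⟩ :=
        S.next hk hG hn hd' hdn hu hcop hQ hPQ haQ hvQ hT hT0 hμ
      refine main fun P hP hlead hpos => IsKeyStage.two_le_aeval hk hres hbr P hP hlead hpos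
        (-(e + (-valDeg v F - valDeg v G))).toNat _ u' U' d' ω' S'
        (κ := e + (-valDeg v F - valDeg v G)) (by rw [hω', hω, WithZero.exp_add]) ?_
        (Int.self_le_toNat _)
      have h2 : (2 : ℤ) ≤ n := by exact_mod_cast hn1
      nlinarith
    · have hn' : n = 1 := by omega
      subst hn'
      obtain ⟨a, rfl⟩ := hQ
      have hva : valDeg v (F ^ a) = valDeg v G := by
        change valDeg v (F ^ a) = d * δ at hvQ
        rw [hvQ, hu, hdn, one_mul]
      have ha : 0 < a := by
        rw [valDeg_zpow] at hva
        have : 0 < a * valDeg v F := by omega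
        exact pos_of_mul_pos_left this hF.le
      obtain ⟨a, rfl⟩ := Int.eq_ofNat_of_zero_le ha.le
      refine hcon ⟨a, μ, ?_⟩
      have hG' : (G : K) = (F : K) ^ a * T := by
        have := congrArg Units.val hT
        simpa using this
      have e : (G : K) - algebraMap k K μ * (F : K) ^ a =
          (F ^ (a : ℤ) : Kˣ) * (T - algebraMap k K μ) := by
        rw [hG', Units.val_zpow_eq_zpow_val, zpow_natCast]
        ring
      rw [e, map_mul, val_eq_exp_valDeg v G, ← hva, ← val_eq_exp_valDeg]
      exact mul_lt_of_lt_one_right (by rw [zero_lt_iff]; exact v.ne_zero_of_unit _) hμ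
  · exact main fun P hP hlead => (S.aeval_low_of_residue hk hG
      (dvd_of_dvd_mul_degree hd' hdn hu hcop) hQ hT hT0 P hP (fun p hp _ => htr p hp) hlead).2

end Reduction

end PolyAut

end

noncomputable section

namespace PolyAut

open scoped WithZero
open WithZero (exp log)

/-! ### The degree valuation on rational functions -/

section DegreeValuation

open MvPolynomial

variable {σ k : Type*} [Field k]

/-- A derivation of a domain extends to its fraction field. -/
theorem exists_derivation_extension {R K : Type*} [CommRing R] [IsDomain R] [Field K] [Algebra R K]
    [IsFractionRing R K] [Algebra k R] [Algebra k K] [IsScalarTower k R K] (D : Derivation k R R) :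
    ∃ D' : Derivation k K K, ∀ r, D' (algebraMap R K r) = algebraMap R K (D r) := by
  -- A derivation is the `ε`-part of an algebra map `r ↦ r + ε D r` into the dual numbers. Nonzero
  -- elements go to units, so the map extends to the fraction field.
  let f : R →ₐ[k] TrivSqZeroExt K K :=
    { toFun := fun r => TrivSqZeroExt.inl (algebraMap R K r) +
        TrivSqZeroExt.inr (algebraMap R K (D r))
      map_one' := by simp
      map_zero' := by simp
      map_add' := fun x y => by ext <;> simp [Algebra.smul_def]
      map_mul' := fun x y => by
        ext
        · simp
        · simp only [map_mul, Derivation.leibniz, smul_eq_mul, map_add, TrivSqZeroExt.snd_add,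
            TrivSqZeroExt.snd_inl, TrivSqZeroExt.snd_inr, TrivSqZeroExt.snd_mul,
            TrivSqZeroExt.fst_add, TrivSqZeroExt.fst_inl, TrivSqZeroExt.fst_inr, zero_add,
            add_zero, op_smul_eq_smul]
      commutes' := fun c => by
        ext
        · simp [TrivSqZeroExt.algebraMap_eq_inl', ← IsScalarTower.algebraMap_apply]
        · simp [TrivSqZeroExt.algebraMap_eq_inl'] }
  have hf : ∀ y : nonZeroDivisors R, IsUnit (f y) := fun y => by
    rw [TrivSqZeroExt.isUnit_iff_isUnit_fst]
    simp [f]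
  let g : K →ₐ[k] TrivSqZeroExt K K := IsLocalization.liftAlgHom (M := nonZeroDivisors R) hf
  have hg : ∀ r, g (algebraMap R K r) = f r := fun r => by
    simp only [g, IsLocalization.liftAlgHom_apply]
    exact IsLocalization.lift_eq _ r
  have hfst : ∀ x, (g x).fst = x := by
    intro x
    have : ((TrivSqZeroExt.fstHom k K K).comp g).toRingHom = RingHom.id K := by
      apply IsLocalization.ringHom_ext (nonZeroDivisors R)
      ext r
      simp [hg, f]
    exact RingHom.congr_fun this x
  refine ⟨Derivation.mk' ((TrivSqZeroExt.sndHom K K).restrictScalars k ∘ₗ g.toLinearMap) ?_, ?_⟩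
  · intro a b
    simp [hfst]
    ring
  · intro r
    change (g (algebraMap R K r)).snd = _
    rw [hg]
    exact (TrivSqZeroExt.snd_add _ _).trans (zero_add _)

theorem totalDegree_pderiv_lt {R : Type*} [CommRing R] (i : σ) (p : MvPolynomial σ R)
    (h : pderiv i p ≠ 0) : (pderiv i p).totalDegree < p.totalDegree := by
  classical
  have hle : ∀ s ∈ (pderiv i p).support, (s.sum fun _ e => e) + 1 ≤ p.totalDegree := by
    intro s hs
    rw [mem_support_iff, coeff_pderiv] at hs
    have h1 : s + Finsupp.single i 1 ∈ p.support := by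
      rw [mem_support_iff]
      intro h0
      simp [h0] at hs
    have h2 := le_totalDegree h1
    rwa [Finsupp.sum_add_index' (fun _ => rfl) (fun _ _ _ => rfl), Finsupp.sum_single_index rfl] at h2
  obtain ⟨s, hs⟩ := support_nonempty.2 h
  refine (Finset.sup_lt_iff ?_).2 fun s hs => hle s hs
  exact lt_of_lt_of_le (Nat.succ_pos _) (hle s hs)

theorem homogeneousComponent_totalDegree_ne_zero {R : Type*} [CommRing R] {p : MvPolynomial σ R}
    (hp : p ≠ 0) : homogeneousComponent p.totalDegree p ≠ 0 := by
  obtain ⟨s, hs, h⟩ := Finset.exists_mem_eq_sup p.support (support_nonempty.2 hp)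
    fun s => s.sum fun _ e => e
  intro h0
  have h1 := coeff_homogeneousComponent p.totalDegree p s
  rw [h0, coeff_zero, if_pos] at h1
  · exact mem_support_iff.1 hs h1.symm
  · exact h.symm

theorem homogeneousComponent_add_mul {R : Type*} [CommRing R] {p q : MvPolynomial σ R} {m n : ℕ}
    (hp : p.totalDegree ≤ m) (hq : q.totalDegree ≤ n) :
    homogeneousComponent (m + n) (p * q) = homogeneousComponent m p * homogeneousComponent n q := by
  have key : ∀ (p : MvPolynomial σ R) (m : ℕ), p.totalDegree ≤ m →
      p = ∑ i ∈ Finset.range (m + 1), homogeneousComponent i p := by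
    intro p m hp
    conv_lhs => rw [← sum_homogeneousComponent p]
    refine Finset.sum_subset (Finset.range_mono (by omega)) fun i _ hi => ?_
    exact homogeneousComponent_eq_zero _ _ (by simpa using hi)
  conv_lhs => rw [key p m hp, key q n hq, Finset.sum_mul_sum]
  rw [map_sum, Finset.sum_eq_single m, map_sum, Finset.sum_eq_single n]
  · rw [homogeneousComponent_of_mem (n := m + n), if_pos rfl]
    exact (homogeneousComponent_isHomogeneous m p).mul (homogeneousComponent_isHomogeneous n q)
  · intro j hj hjn
    rw [homogeneousComponent_of_mem (n := m + j), if_neg (by omega)]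
    exact (homogeneousComponent_isHomogeneous m p).mul (homogeneousComponent_isHomogeneous j q)
  · simp
  · intro i hi him
    rw [map_sum]
    refine Finset.sum_eq_zero fun j hj => ?_
    simp only [Finset.mem_range] at hi hj
    rw [homogeneousComponent_of_mem (n := i + j), if_neg (by omega)]
    exact (homogeneousComponent_isHomogeneous i p).mul (homogeneousComponent_isHomogeneous j q)
  · simp

theorem homogeneousComponent_mul_pow {R : Type*} [CommRing R] {p : MvPolynomial σ R} {m : ℕ}
    (hp : p.totalDegree ≤ m) (n : ℕ) :
    homogeneousComponent (n * m) (p ^ n) = homogeneousComponent m p ^ n := by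
  induction n with
  | zero => simp
  | succ n ih =>
    rw [pow_succ, pow_succ, add_mul, one_mul, homogeneousComponent_add_mul _ hp, ih]
    exact (totalDegree_pow p n).trans (Nat.mul_le_mul_left n hp)

open Classical in
/-- The exponential of the total degree. -/
def expDegree (p : MvPolynomial σ k) : ℤᵐ⁰ := if p = 0 then 0 else exp (p.totalDegree : ℤ)

theorem expDegree_zero : expDegree (0 : MvPolynomial σ k) = 0 := if_pos rfl

theorem expDegree_of_ne_zero {p : MvPolynomial σ k} (hp : p ≠ 0) :
    expDegree p = exp (p.totalDegree : ℤ) := if_neg hp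

/-- The degree valuation on a polynomial ring over a field. -/
def degVal (σ k : Type*) [Field k] : Valuation (MvPolynomial σ k) ℤᵐ⁰ where
  toFun := expDegree
  map_zero' := expDegree_zero
  map_one' := by rw [expDegree_of_ne_zero one_ne_zero]; simp
  map_mul' p q := by
    by_cases hp : p = 0
    · simp [hp, expDegree_zero]
    by_cases hq : q = 0
    · simp [hq, expDegree_zero]
    rw [expDegree_of_ne_zero hp, expDegree_of_ne_zero hq, expDegree_of_ne_zero (mul_ne_zero hp hq),
      ← WithZero.exp_add, totalDegree_mul_of_isDomain hp hq, Nat.cast_add]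
  map_add_le_max' p q := by
    by_cases hp : p = 0
    · simp [hp, expDegree_zero]
    by_cases hq : q = 0
    · simp [hq, expDegree_zero]
    by_cases hpq : p + q = 0
    · simp [hpq, expDegree_zero]
    rw [expDegree_of_ne_zero hp, expDegree_of_ne_zero hq, expDegree_of_ne_zero hpq, le_max_iff,
      WithZero.exp_le_exp, WithZero.exp_le_exp, Nat.cast_le, Nat.cast_le, ← le_max_iff]
    exact totalDegree_add p q

theorem degVal_apply {p : MvPolynomial σ k} (hp : p ≠ 0) :
    degVal σ k p = exp (p.totalDegree : ℤ) := expDegree_of_ne_zero hp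

theorem degVal_lt_iff {p : MvPolynomial σ k} {n : ℕ} (h : p.totalDegree ≤ n) :
    degVal σ k p < exp (n : ℤ) ↔ homogeneousComponent n p = 0 := by
  by_cases hp : p = 0
  · subst hp
    simp [zero_lt_iff]
  · rw [degVal_apply hp, WithZero.exp_lt_exp, Nat.cast_lt]
    constructor
    · exact homogeneousComponent_eq_zero _ _
    · intro h0
      refine lt_of_le_of_ne h fun he => ?_
      subst he
      exact homogeneousComponent_totalDegree_ne_zero hp h0

theorem degVal_supp_le :
    nonZeroDivisors (MvPolynomial σ k) ≤ (degVal σ k).supp.primeCompl := by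
  intro p hp
  have hp0 : p ≠ 0 := nonZeroDivisors.ne_zero hp
  intro h
  have h' : degVal σ k p = 0 := h
  rw [degVal_apply hp0] at h'
  exact WithZero.exp_ne_zero h'

/-- The degree valuation on the field of rational functions. -/
def fracDegVal (σ k : Type*) [Field k] : Valuation (FractionRing (MvPolynomial σ k)) ℤᵐ⁰ :=
  (degVal σ k).extendToLocalization degVal_supp_le _

theorem fracDegVal_algebraMap (p : MvPolynomial σ k) :
    fracDegVal σ k (algebraMap _ _ p) = degVal σ k p :=
  Valuation.extendToLocalization_apply_map_apply _ _ _ _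

theorem fracDegVal_const {c : k} (hc : c ≠ 0) :
    fracDegVal σ k (algebraMap k _ c) = 1 := by
  rw [IsScalarTower.algebraMap_apply k (MvPolynomial σ k), fracDegVal_algebraMap, algebraMap_eq,
    degVal_apply (by simpa using hc)]
  simp

theorem degVal_pderiv_le (i : σ) (p : MvPolynomial σ k) :
    degVal σ k (pderiv i p) ≤ degVal σ k p * exp (-1 : ℤ) := by
  by_cases h : pderiv i p = 0
  · simp [h]
  have hp : p ≠ 0 := by
    rintro rfl
    simp at h
  rw [degVal_apply h, degVal_apply hp, ← WithZero.exp_add, WithZero.exp_le_exp]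
  have := totalDegree_pderiv_lt i p h
  omega

theorem fracDegVal_derivation_le (i : σ)
    {D : Derivation k (FractionRing (MvPolynomial σ k)) (FractionRing (MvPolynomial σ k))}
    (hD : ∀ p : MvPolynomial σ k, D (algebraMap _ _ p) = algebraMap _ _ (pderiv i p))
    (x : FractionRing (MvPolynomial σ k)) :
    fracDegVal σ k (D x) ≤ fracDegVal σ k x * exp (-1 : ℤ) := by
  obtain ⟨a, b, hb, rfl⟩ := IsFractionRing.div_surjective (A := MvPolynomial σ k) x
  have hb0 : (algebraMap (MvPolynomial σ k) (FractionRing (MvPolynomial σ k))) b ≠ 0 := by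
    simpa using nonZeroDivisors.ne_zero hb
  have hvb : fracDegVal σ k (algebraMap (MvPolynomial σ k) _ b) ≠ 0 := (Valuation.ne_zero_iff _).2 hb0
  rw [Derivation.leibniz_div, hD, hD, smul_eq_mul, smul_eq_mul, smul_eq_mul, map_mul, map_pow,
    map_inv₀, map_div₀]
  have key : fracDegVal σ k (algebraMap (MvPolynomial σ k) _ b * algebraMap _ _ (pderiv i a) -
      algebraMap (MvPolynomial σ k) _ a * algebraMap _ _ (pderiv i b)) ≤
      fracDegVal σ k (algebraMap (MvPolynomial σ k) _ b) *
        fracDegVal σ k (algebraMap (MvPolynomial σ k) _ a) * exp (-1 : ℤ) := by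
    refine Valuation.map_sub_le _ ?_ ?_
    · rw [map_mul, fracDegVal_algebraMap, fracDegVal_algebraMap, fracDegVal_algebraMap, mul_assoc]
      exact mul_le_mul_right (degVal_pderiv_le i a) _
    · rw [map_mul, fracDegVal_algebraMap, fracDegVal_algebraMap, fracDegVal_algebraMap,
        mul_comm (degVal σ k b), mul_assoc]
      exact mul_le_mul_right (degVal_pderiv_le i b) _
  refine (mul_le_mul_right key _).trans (le_of_eq ?_)
  generalize fracDegVal σ k (algebraMap (MvPolynomial σ k) (FractionRing (MvPolynomial σ k)) b) = β at hvb ⊢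
  field_simp

/-- The field `k` is algebraically closed in the residue field. The residue of `T = a / b` is the
ratio of the leading forms; if it is algebraic over `k`, it is integral over the polynomial ring,
hence a polynomial, and by degrees a constant. -/
theorem fracDegVal_residue (T : (FractionRing (MvPolynomial σ k))ˣ)
    (hT : valDeg (fracDegVal σ k) T = 0) :
    (∃ μ : k, fracDegVal σ k ((T : FractionRing (MvPolynomial σ k)) - algebraMap k _ μ) < 1) ∨
      ∀ p : Polynomial k, p ≠ 0 →
        fracDegVal σ k (Polynomial.aeval (T : FractionRing (MvPolynomial σ k)) p) = 1 := by
  rw [← val_eq_one_iff_valDeg] at hT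
  obtain ⟨a, b, hb, hab⟩ := IsFractionRing.div_surjective (A := MvPolynomial σ k)
    (T : FractionRing (MvPolynomial σ k))
  have hb0 : b ≠ 0 := nonZeroDivisors.ne_zero hb
  have hb' : (algebraMap (MvPolynomial σ k) (FractionRing (MvPolynomial σ k))) b ≠ 0 := by
    simpa using hb0
  have ha0 : a ≠ 0 := by
    rintro rfl
    rw [map_zero, zero_div] at hab
    exact T.ne_zero hab.symm
  have hvb : fracDegVal σ k (algebraMap _ _ b) ≠ 0 := (Valuation.ne_zero_iff _).2 hb'
  have hdeg : a.totalDegree = b.totalDegree := by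
    rw [← hab, map_div₀, div_eq_one_iff_eq hvb, fracDegVal_algebraMap, fracDegVal_algebraMap,
      degVal_apply ha0, degVal_apply hb0, WithZero.exp_inj] at hT
    exact_mod_cast hT
  obtain ⟨d, hd⟩ : ∃ d, d = b.totalDegree := ⟨_, rfl⟩
  have htopa : homogeneousComponent d a ≠ 0 := by
    rw [hd, ← hdeg]
    exact homogeneousComponent_totalDegree_ne_zero ha0
  have htopb : homogeneousComponent d b ≠ 0 := by
    rw [hd]
    exact homogeneousComponent_totalDegree_ne_zero hb0
  rw [or_iff_not_imp_right]
  intro hcon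
  push Not at hcon
  obtain ⟨p, hp, hvp⟩ := hcon
  -- The homogenization of `p` evaluated at `(a, b)`, that is, `b ^ deg p * p(a / b)`. A drop in
  -- degree makes its top component vanish, so the ratio of leading forms is a root of `p`.
  let W : MvPolynomial σ k := ∑ j ∈ Finset.range (p.natDegree + 1),
    C (p.coeff j) * (a ^ j * b ^ (p.natDegree - j))
  have hW : Polynomial.aeval (T : FractionRing (MvPolynomial σ k)) p *
      algebraMap _ _ b ^ p.natDegree = algebraMap _ _ W := by
    rw [Polynomial.aeval_eq_sum_range, Finset.sum_mul, map_sum]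
    refine Finset.sum_congr rfl fun j hj => ?_
    have hj' : j ≤ p.natDegree := Nat.lt_succ_iff.1 (Finset.mem_range.1 hj)
    rw [Algebra.smul_def, ← hab, map_mul, map_mul, map_pow, map_pow, ← algebraMap_eq,
      ← IsScalarTower.algebraMap_apply, div_pow]
    conv_lhs => rw [← Nat.add_sub_of_le hj', pow_add]
    field_simp
  have hdegterm : ∀ j ∈ Finset.range (p.natDegree + 1),
      (C (p.coeff j) * (a ^ j * b ^ (p.natDegree - j))).totalDegree ≤ p.natDegree * d := by
    intro j hj
    have hj' : j ≤ p.natDegree := Nat.lt_succ_iff.1 (Finset.mem_range.1 hj)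
    refine (totalDegree_mul _ _).trans ?_
    rw [totalDegree_C, zero_add]
    refine (totalDegree_mul _ _).trans ?_
    refine (add_le_add (totalDegree_pow a j) (totalDegree_pow b _)).trans ?_
    rw [hdeg, ← hd, ← add_mul, Nat.add_sub_of_le hj']
  have hWdeg : W.totalDegree ≤ p.natDegree * d :=
    (totalDegree_finsetSum _ _).trans (Finset.sup_le hdegterm)
  have hWv : degVal σ k W < exp ((p.natDegree * d : ℕ) : ℤ) := by
    have hle : degVal σ k W ≤ exp ((p.natDegree * d : ℕ) : ℤ) := by
      by_cases h0 : W = 0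
      · simp [h0]
      · rw [degVal_apply h0, WithZero.exp_le_exp]
        exact_mod_cast hWdeg
    refine lt_of_le_of_ne hle fun he => hvp ?_
    have h1 := congrArg (fracDegVal σ k) hW
    rw [map_mul, map_pow, fracDegVal_algebraMap, fracDegVal_algebraMap, he, degVal_apply hb0,
      ← hd, ← WithZero.exp_nsmul, nsmul_eq_mul, Nat.cast_mul] at h1
    exact mul_right_cancel₀ WithZero.exp_ne_zero (h1.trans (one_mul _).symm)
  rw [degVal_lt_iff hWdeg] at hWv
  have hWtop : homogeneousComponent (p.natDegree * d) W = ∑ j ∈ Finset.range (p.natDegree + 1),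
      C (p.coeff j) *
        (homogeneousComponent d a ^ j * homogeneousComponent d b ^ (p.natDegree - j)) := by
    simp only [W, map_sum]
    refine Finset.sum_congr rfl fun j hj => ?_
    have hj' : j ≤ p.natDegree := Nat.lt_succ_iff.1 (Finset.mem_range.1 hj)
    rw [homogeneousComponent_C_mul]
    congr 1
    conv_lhs => rw [← Nat.add_sub_of_le hj', add_mul]
    rw [Nat.add_sub_cancel_left, homogeneousComponent_add_mul, homogeneousComponent_mul_pow,
      homogeneousComponent_mul_pow]
    · exact hd.ge
    · rw [hdeg, hd]
    · refine (totalDegree_pow _ _).trans ?_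
      rw [hdeg, hd]
    · refine (totalDegree_pow _ _).trans ?_
      rw [hd]
  rw [hWtop] at hWv
  let A := algebraMap (MvPolynomial σ k) (FractionRing (MvPolynomial σ k)) (homogeneousComponent d a)
  let B := algebraMap (MvPolynomial σ k) (FractionRing (MvPolynomial σ k)) (homogeneousComponent d b)
  have hB : B ≠ 0 := by simpa [B] using htopb
  have hroot : Polynomial.aeval (A / B) p = 0 := by
    have h1 := congrArg (algebraMap (MvPolynomial σ k) (FractionRing (MvPolynomial σ k))) hWv
    rw [map_zero, map_sum] at h1
    have h2 : Polynomial.aeval (A / B) p * B ^ p.natDegree = 0 := by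
      rw [← h1, Polynomial.aeval_eq_sum_range, Finset.sum_mul]
      refine Finset.sum_congr rfl fun j hj => ?_
      have hj' : j ≤ p.natDegree := Nat.lt_succ_iff.1 (Finset.mem_range.1 hj)
      rw [Algebra.smul_def, map_mul, map_mul, map_pow, map_pow, ← algebraMap_eq,
        ← IsScalarTower.algebraMap_apply, div_pow]
      conv_lhs => rw [← Nat.add_sub_of_le hj', pow_add]
      change _ = _ * (A ^ j * B ^ _)
      field_simp
    exact (mul_eq_zero.1 h2).resolve_right (pow_ne_zero _ hB)
  have halg : IsAlgebraic k (A / B) := ⟨p, hp, hroot⟩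
  obtain ⟨y, hy⟩ := IsIntegrallyClosed.isIntegral_iff.1
    (halg.isIntegral.tower_top (A := MvPolynomial σ k))
  have hyab : homogeneousComponent d a = y * homogeneousComponent d b := by
    apply IsFractionRing.injective (MvPolynomial σ k) (FractionRing (MvPolynomial σ k))
    rw [map_mul, hy]
    exact (div_mul_cancel₀ A hB).symm
  have hy0 : y ≠ 0 := by
    rintro rfl
    rw [zero_mul] at hyab
    exact htopa hyab
  have hydeg : y.totalDegree = 0 := by
    have h1 := totalDegree_mul_of_isDomain hy0 htopb
    rw [← hyab, (homogeneousComponent_isHomogeneous d a).totalDegree htopa,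
      (homogeneousComponent_isHomogeneous d b).totalDegree htopb] at h1
    omega
  rw [totalDegree_eq_zero_iff_eq_C] at hydeg
  refine ⟨coeff 0 y, ?_⟩
  have hlt : degVal σ k (a - C (coeff 0 y) * b) < exp (d : ℤ) := by
    rw [degVal_lt_iff]
    · rw [map_sub, homogeneousComponent_C_mul, ← hydeg, hyab, sub_self]
    · refine (totalDegree_sub _ _).trans (max_le (by rw [hdeg, hd]) ?_)
      refine (totalDegree_mul _ _).trans ?_
      rw [totalDegree_C, zero_add, hd]
  have e : (T : FractionRing (MvPolynomial σ k)) - algebraMap k _ (coeff 0 y) =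
      algebraMap _ _ (a - C (coeff 0 y) * b) / algebraMap _ _ b := by
    rw [← hab, map_sub, map_mul, ← algebraMap_eq, ← IsScalarTower.algebraMap_apply]
    field_simp
  rw [e, map_div₀, div_lt_one₀ (zero_lt_iff.2 hvb), fracDegVal_algebraMap, fracDegVal_algebraMap,
    degVal_apply hb0, ← hd]
  exact hlt

end DegreeValuation

end PolyAut

end

noncomputable section

namespace PolyAut

open scoped WithZero
open WithZero (exp log)

/-! ### Elementary automorphisms and shears -/

section Elementary

open MvPolynomial

variable {n : ℕ} {R : Type*} [CommRing R]

theorem elementary_mem_EA (i : Fin n) (f : supported R ({i}ᶜ : Set (Fin n))) :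
    elementary i f ∈ EA n R := Subgroup.subset_closure ⟨i, f, rfl⟩

theorem pderiv_eq_zero_of_mem_supported {i : Fin n} {f : MvPolynomial (Fin n) R}
    (hf : f ∈ supported R ({i}ᶜ : Set (Fin n))) : pderiv i f = 0 := by
  refine pderiv_eq_zero_of_notMem_vars fun h => ?_
  exact (mem_supported.1 hf) h rfl

/-- The Jacobian matrix is a rank-one perturbation of the identity, with determinant `1 + ∂f/∂X_i`.
-/
theorem elementary_mem_SA (i : Fin n) (f : supported R ({i}ᶜ : Set (Fin n))) :
    elementary i f ∈ SA n R := by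
  change (jacobian (elementary i f)).det = 1
  have h : jacobian (elementary i f) = 1 + Matrix.replicateCol Unit (Pi.single i (1 : MvPolynomial (Fin n) R)) *
      Matrix.replicateRow Unit (fun j => pderiv j (f : MvPolynomial (Fin n) R)) := by
    ext1 a b
    rw [jacobian, Matrix.of_apply, coord_elementary, Matrix.add_apply, Matrix.mul_apply]
    by_cases h : a = i
    · subst h
      simp [pderiv_X, Matrix.one_apply, Pi.single_apply]
    · simp [h, pderiv_X, Matrix.one_apply, Pi.single_apply]
  rw [h, Matrix.det_one_add_replicateCol_mul_replicateRow]
  simp [pderiv_eq_zero_of_mem_supported f.2]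

theorem EA_le_SA : EA n R ≤ SA n R := by
  refine (Subgroup.closure_le _).2 ?_
  rintro _ ⟨i, f, rfl⟩
  exact elementary_mem_SA i f

/-- The elementary automorphism adding `p(X_i)` to `X_j`. -/
def shear {i j : Fin n} (hij : i ≠ j) (p : Polynomial R) : GA n R :=
  elementary j ⟨Polynomial.aeval (X i) p, by
    rw [Polynomial.aeval_eq_sum_range]
    exact sum_mem fun m _ => Subalgebra.smul_mem _
      (pow_mem (show X i ∈ supported R ({j}ᶜ : Set (Fin n)) from
        Algebra.subset_adjoin ⟨i, by simpa using hij, rfl⟩) _) _⟩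

theorem shear_mem_EA {i j : Fin n} (hij : i ≠ j) (p : Polynomial R) : shear hij p ∈ EA n R :=
  elementary_mem_EA _ _

theorem coord_shear_mul {i j : Fin n} (hij : i ≠ j) (p : Polynomial R) (φ : GA n R) (l : Fin n) :
    coord (shear hij p * φ) l =
      if l = j then coord φ j + Polynomial.aeval (coord φ i) p else coord φ l := by
  rw [coord_mul, shear, coord_elementary]
  split_ifs
  · rw [map_add, bind₁_X_right, ← Polynomial.aeval_algHom_apply, bind₁_X_right]
  · rw [bind₁_X_right]

theorem mem_EA_of_shear_mul_mem {i j : Fin n} (hij : i ≠ j) (p : Polynomial R) {φ : GA n R}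
    (h : shear hij p * φ ∈ EA n R) : φ ∈ EA n R :=
  ((EA n R).mul_mem_cancel_left (shear_mem_EA hij p)).1 h

end Elementary

/-! ### Affine automorphisms of the plane -/

section AffinePlane

open MvPolynomial

variable {k : Type*} [Field k]

theorem mem_EA_of_translation {φ : GA 2 k} {e f : k} (h0 : coord φ 0 = X 0 + C e)
    (h1 : coord φ 1 = X 1 + C f) : φ ∈ EA 2 k := by
  refine mem_EA_of_shear_mul_mem (i := 1) (j := 0) (by decide) (Polynomial.C (-e)) ?_
  refine mem_EA_of_shear_mul_mem (i := 0) (j := 1) (by decide) (Polynomial.C (-f)) ?_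
  convert (EA 2 k).one_mem
  refine ext_coord fun i => ?_
  fin_cases i <;> simp [coord_shear_mul, h0, h1, ← algebraMap_eq]

/-- Row reduction in `SL_2`, each row operation being a shear. -/
theorem mem_EA_of_affine {φ : GA 2 k} {a b c d e f : k}
    (h0 : coord φ 0 = C a * X 0 + C b * X 1 + C e)
    (h1 : coord φ 1 = C c * X 0 + C d * X 1 + C f) (hdet : a * d - b * c = 1) : φ ∈ EA 2 k := by
  have step3 : ∀ {φ : GA 2 k} {b e f : k}, coord φ 0 = X 0 + C b * X 1 + C e →
      coord φ 1 = X 1 + C f → φ ∈ EA 2 k := by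
    intro φ b e f h0 h1
    refine mem_EA_of_shear_mul_mem (i := 1) (j := 0) (by decide)
      (Polynomial.C (-b) * Polynomial.X) ?_
    refine mem_EA_of_translation (e := e - b * f) (f := f) ?_ ?_
    · simp only [coord_shear_mul, if_true, h0, h1, map_mul, Polynomial.aeval_C, Polynomial.aeval_X,
        algebraMap_eq, map_sub, map_neg]
      ring
    · simp [coord_shear_mul, h1]
  have step2 : ∀ {φ : GA 2 k} {b c d e f : k}, coord φ 0 = X 0 + C b * X 1 + C e →
      coord φ 1 = C c * X 0 + C d * X 1 + C f → d - b * c = 1 → φ ∈ EA 2 k := by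
    intro φ b c d e f h0 h1 hdet
    refine mem_EA_of_shear_mul_mem (i := 0) (j := 1) (by decide)
      (Polynomial.C (-c) * Polynomial.X) ?_
    refine step3 (b := b) (e := e) (f := f - c * e) ?_ ?_
    · simp [coord_shear_mul, h0]
    · have hd : d = 1 + b * c := by rw [← hdet]; ring
      simp only [coord_shear_mul, if_true, h0, h1, hd, map_mul, Polynomial.aeval_C,
        Polynomial.aeval_X, algebraMap_eq, map_sub, map_neg, map_add, map_one]
      ring
  have step1 : ∀ {φ : GA 2 k} {a b c d e f : k}, coord φ 0 = C a * X 0 + C b * X 1 + C e →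
      coord φ 1 = C c * X 0 + C d * X 1 + C f → a * d - b * c = 1 → c ≠ 0 → φ ∈ EA 2 k := by
    intro φ a b c d e f h0 h1 hdet hc
    refine mem_EA_of_shear_mul_mem (i := 1) (j := 0) (by decide)
      (Polynomial.C ((1 - a) / c) * Polynomial.X) ?_
    refine step2 (b := b + (1 - a) / c * d) (c := c) (d := d) (e := e + (1 - a) / c * f) (f := f)
      ?_ ?_ ?_
    · have h : (C ((1 - a) / c) * C c : MvPolynomial (Fin 2) k) = 1 - C a := by
        rw [← map_mul, div_mul_cancel₀ _ hc, map_sub, map_one]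
      simp only [coord_shear_mul, if_true, h0, h1, map_mul, Polynomial.aeval_C, Polynomial.aeval_X,
        algebraMap_eq, map_add]
      linear_combination (X 0 : MvPolynomial (Fin 2) k) * h
    · simp [coord_shear_mul, h1]
    · field_simp
      linear_combination hdet
  -- If `c = 0` then `a ≠ 0`, and adding the first row to the second makes the lower left entry
  -- nonzero.
  by_cases hc : c = 0
  · refine mem_EA_of_shear_mul_mem (i := 0) (j := 1) (by decide) Polynomial.X ?_
    refine step1 (a := a) (b := b) (c := c + a) (d := d + b) (e := e) (f := f + e) ?_ ?_ ?_ ?_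
    · simp [coord_shear_mul, h0]
    · simp only [coord_shear_mul, if_true, h0, h1, Polynomial.aeval_X, map_add]
      ring
    · linear_combination hdet
    · rintro h
      rw [hc, zero_add] at h
      simp [h, hc] at hdet
  · exact step1 h0 h1 hdet hc

theorem eq_affine_of_totalDegree_le_one {p : MvPolynomial (Fin 2) k} (hp : p.totalDegree ≤ 1) :
    ∃ a b e : k, p = C a * X 0 + C b * X 1 + C e := by
  have hsum : p = homogeneousComponent 0 p + homogeneousComponent 1 p := by
    conv_lhs => rw [← sum_homogeneousComponent p]
    rw [Finset.sum_subset (Finset.range_mono (Nat.succ_le_succ hp)) fun i _ hi =>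
      homogeneousComponent_eq_zero _ _ (by simpa using hi)]
    simp [Finset.sum_range_succ]
  have h1 := homogeneousComponent_mem (φ := p) (n := 1)
  rw [homogeneousSubmodule_one_eq_span_X, Submodule.mem_span_range_iff_exists_fun] at h1
  obtain ⟨c, hc⟩ := h1
  refine ⟨c 0, c 1, coeff 0 p, ?_⟩
  conv_lhs => rw [hsum, ← hc, homogeneousComponent_zero]
  simp [smul_eq_C_mul]
  ring

end AffinePlane

/-! ### The Jung–van der Kulk theorem for special automorphisms -/

section Jung

open MvPolynomial

variable {k : Type*} [Field k]

/-- Elements of `k[F, G]` are polynomials in `G` with coefficients in `k[F]`, not merely `k(F)`;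
this supplies the bound on leading coefficients. -/
theorem exists_polynomial_of_mem_adjoin {R K : Type*} [CommRing R] [Field K] [Algebra R K]
    [Algebra k R] [Algebra k K] [IsScalarTower k R K] {F G h : R}
    (hh : h ∈ Algebra.adjoin k {F, G}) :
    ∃ P : Polynomial (IntermediateField.adjoin k {algebraMap R K F}),
      Polynomial.aeval (algebraMap R K G) P = algebraMap R K h ∧
        ∀ n, (P.coeff n : K) ∈ (Polynomial.aeval (R := k) (algebraMap R K F)).range := by
  induction hh using Algebra.adjoin_induction with
  | mem x hx =>
    rcases hx with rfl | rfl
    · refine ⟨Polynomial.C ⟨algebraMap R K x, IntermediateField.mem_adjoin_simple_self _ _⟩, ?_,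
        fun n => ?_⟩
      · rw [Polynomial.aeval_C]
        rfl
      · rw [Polynomial.coeff_C]
        split_ifs
        · exact ⟨Polynomial.X, Polynomial.aeval_X _⟩
        · exact zero_mem _
    · refine ⟨Polynomial.X, Polynomial.aeval_X _, fun n => ?_⟩
      rw [Polynomial.coeff_X]
      split_ifs
      · exact one_mem _
      · exact zero_mem _
  | algebraMap c =>
    refine ⟨Polynomial.C (algebraMap k _ c), ?_, fun n => ?_⟩
    · rw [Polynomial.aeval_C, ← IsScalarTower.algebraMap_apply, ← IsScalarTower.algebraMap_apply]
    · rw [Polynomial.coeff_C]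
      split_ifs
      · exact Subalgebra.algebraMap_mem _ c
      · exact zero_mem _
  | add x y _ _ hx hy =>
    obtain ⟨P, hP, hP'⟩ := hx
    obtain ⟨Q, hQ, hQ'⟩ := hy
    refine ⟨P + Q, by rw [map_add, hP, hQ, map_add], fun n => ?_⟩
    rw [Polynomial.coeff_add]
    exact add_mem (hP' n) (hQ' n)
  | mul x y _ _ hx hy =>
    obtain ⟨P, hP, hP'⟩ := hx
    obtain ⟨Q, hQ, hQ'⟩ := hy
    refine ⟨P * Q, by rw [map_mul, hP, hQ, map_mul], fun n => ?_⟩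
    rw [Polynomial.coeff_mul]
    push_cast
    exact sum_mem fun i _ => mul_mem (hP' _) (hQ' _)

theorem one_le_val_aeval {K : Type*} [Field K] [Algebra k K] {v : Valuation K ℤᵐ⁰}
    (hk : ∀ c : k, c ≠ 0 → v (algebraMap k K c) = 1) {F : Kˣ} (hF : 0 < valDeg v F)
    {r : Polynomial k} (hr : r ≠ 0) : 1 ≤ v (Polynomial.aeval (F : K) r) := by
  rw [val_eq_of_val_sub_const_mul_lt hk (Polynomial.leadingCoeff_ne_zero.2 hr)
    (val_aeval_sub_lt hk hF r), map_pow, val_eq_exp_valDeg]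
  refine one_le_pow₀ ?_
  rw [← WithZero.exp_zero, WithZero.exp_le_exp]
  exact hF.le

/-- If `k[F, G] = k[x, y]` and the Jacobian of `F` and `G` is `±1`, then the larger of the two
degrees can be lowered by an elementary transformation, unless both degrees are one. -/
theorem exists_degree_reduction {F G : MvPolynomial (Fin 2) k}
    (hJ : degVal (Fin 2) k (pderiv 0 F * pderiv 1 G - pderiv 1 F * pderiv 0 G) = 1)
    (hgen : ∀ i : Fin 2, X i ∈ Algebra.adjoin k {F, G}) (hF : 0 < F.totalDegree)
    (hFG : F.totalDegree ≤ G.totalDegree) (hG : 2 ≤ G.totalDegree) :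
    ∃ (a : ℕ) (μ : k), (G - C μ * F ^ a).totalDegree < G.totalDegree := by
  obtain ⟨D₁, hD₁⟩ := exists_derivation_extension (K := FractionRing (MvPolynomial (Fin 2) k))
    (pderiv (R := k) (0 : Fin 2))
  obtain ⟨D₂, hD₂⟩ := exists_derivation_extension (K := FractionRing (MvPolynomial (Fin 2) k))
    (pderiv (R := k) (1 : Fin 2))
  let ι := algebraMap (MvPolynomial (Fin 2) k) (FractionRing (MvPolynomial (Fin 2) k))
  have hF0 : F ≠ 0 := by
    rintro rfl
    simp at hF
  have hG0 : G ≠ 0 := by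
    rintro rfl
    simp at hG
  have hι : ∀ {p : MvPolynomial (Fin 2) k}, p ≠ 0 → ι p ≠ 0 := fun hp => by simpa [ι] using hp
  have hv : ∀ p, fracDegVal (Fin 2) k (ι p) = degVal (Fin 2) k p := fracDegVal_algebraMap
  let F' : (FractionRing (MvPolynomial (Fin 2) k))ˣ := Units.mk0 (ι F) (hι hF0)
  let G' : (FractionRing (MvPolynomial (Fin 2) k))ˣ := Units.mk0 (ι G) (hι hG0)
  have hvF : valDeg (fracDegVal (Fin 2) k) F' = F.totalDegree := by
    rw [valDeg_eq_iff, ← degVal_apply hF0]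
    exact hv F
  have hvG : valDeg (fracDegVal (Fin 2) k) G' = G.totalDegree := by
    rw [valDeg_eq_iff, ← degVal_apply hG0]
    exact hv G
  have hvX : ∀ μ : k, degVal (Fin 2) k (X 0 - C μ * X 1) = exp (1 : ℤ) := by
    intro μ
    have hne : (X 0 - C μ * X 1 : MvPolynomial (Fin 2) k) ≠ 0 := by
      intro h
      have := congrArg (coeff (Finsupp.single 0 1)) h
      simp [coeff_C_mul, coeff_X, Finsupp.single_left_inj] at this
    have hhom : (X 0 - C μ * X 1 : MvPolynomial (Fin 2) k).IsHomogeneous 1 :=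
      (isHomogeneous_X k 0).sub (isHomogeneous_C_mul_X μ 1)
    rw [degVal_apply hne, hhom.totalDegree hne]
    rfl
  have hX1 : degVal (Fin 2) k (X 1) = exp (1 : ℤ) := by
    rw [degVal_apply (X_ne_zero _), totalDegree_X]
    rfl
  have hred := exists_reduction (v := fracDegVal (Fin 2) k) (D₁ := D₁) (D₂ := D₂)
    (fun c hc => fracDegVal_const hc) fracDegVal_residue
    (val_logBr_le (fracDegVal_derivation_le 0 hD₁) (fracDegVal_derivation_le 1 hD₂))
    (F := F') (G := G') (by rw [hvF]; exact_mod_cast hF) (by rw [hvF, hvG]; exact_mod_cast hFG)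
    (by rw [hvG]; exact_mod_cast hG) ?_ (x := ι (X 0)) (y := ι (X 1)) (by rw [hv, hX1]) ?_ ?_
  · obtain ⟨a, μ, h⟩ := hred
    refine ⟨a, μ, ?_⟩
    have e : (G' : FractionRing (MvPolynomial (Fin 2) k)) -
        algebraMap k _ μ * (F' : FractionRing (MvPolynomial (Fin 2) k)) ^ a =
        ι (G - C μ * F ^ a) := by
      rw [map_sub, map_mul, map_pow, ← algebraMap_eq, ← IsScalarTower.algebraMap_apply]
      rfl
    have e' : (G' : FractionRing (MvPolynomial (Fin 2) k)) = ι G := rfl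
    rw [e, e', hv, hv, degVal_apply hG0] at h
    by_cases h0 : G - C μ * F ^ a = 0
    · rw [h0, totalDegree_zero]
      omega
    · rw [degVal_apply h0, WithZero.exp_lt_exp] at h
      exact_mod_cast h
  · have e : logBr D₁ D₂ F' G' = (F' : FractionRing (MvPolynomial (Fin 2) k))⁻¹ *
        (G' : FractionRing (MvPolynomial (Fin 2) k))⁻¹ *
        ι (pderiv 0 F * pderiv 1 G - pderiv 1 F * pderiv 0 G) := by
      rw [logBr, toAdd_logDer, toAdd_logDer, toAdd_logDer, toAdd_logDer, map_sub, map_mul, map_mul]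
      change _⁻¹ * D₁ (ι F) * (_⁻¹ * D₂ (ι G)) - _⁻¹ * D₂ (ι F) * (_⁻¹ * D₁ (ι G)) = _
      rw [hD₁, hD₁, hD₂, hD₂]
      change _ * ι _ * (_ * ι _) - _ * ι _ * (_ * ι _) = _
      ring
    rw [e, map_mul, hv, hJ, mul_one, map_mul, map_inv₀, map_inv₀, val_eq_exp_valDeg,
      val_eq_exp_valDeg, ← WithZero.exp_neg, ← WithZero.exp_neg, ← WithZero.exp_add]
    rfl
  · intro μ
    rw [← hvX μ, ← hv]
    congr 1
    rw [map_sub, map_mul, ← algebraMap_eq, ← IsScalarTower.algebraMap_apply]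
  · intro z hz
    obtain ⟨i, rfl⟩ : ∃ i, z = ι (X i) := by
      rcases hz with rfl | rfl
      exacts [⟨0, rfl⟩, ⟨1, rfl⟩]
    obtain ⟨P, hP, hP'⟩ := exists_polynomial_of_mem_adjoin
      (K := FractionRing (MvPolynomial (Fin 2) k)) (hgen i)
    refine ⟨P, hP, fun hP0 => ?_⟩
    obtain ⟨r, hr⟩ := hP' P.natDegree
    have hr0 : r ≠ 0 := by
      rintro rfl
      rw [map_zero] at hr
      refine hP0 (Polynomial.leadingCoeff_eq_zero.1 ?_)
      exact Subtype.ext hr.symm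
    have h2 := one_le_val_aeval (v := fracDegVal (Fin 2) k) (fun c hc => fracDegVal_const hc)
      (F := F') (by rw [hvF]; exact_mod_cast hF) hr0
    have h3 : Polynomial.aeval (F' : FractionRing (MvPolynomial (Fin 2) k)) r =
        (P.coeff P.natDegree : FractionRing (MvPolynomial (Fin 2) k)) := hr
    rw [h3] at h2
    exact h2

theorem X_mem_adjoin_coord (φ : GA 2 k) (i : Fin 2) :
    X i ∈ Algebra.adjoin k {coord φ 0, coord φ 1} := by
  have h1 : (X i : MvPolynomial (Fin 2) k) = aeval (coord φ) (φ.unop.symm (X i)) := by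
    have := unop_apply φ (φ.unop.symm (X i))
    rw [AlgEquiv.apply_symm_apply] at this
    exact this
  have h2 : Set.range (coord φ) = {coord φ 0, coord φ 1} := by
    ext x
    simp [Fin.exists_fin_two, eq_comm]
  rw [← h2, Algebra.adjoin_range_eq_range_aeval, h1]
  exact ⟨_, rfl⟩

theorem det_jacobian_two {R : Type*} [CommRing R] (φ : GA 2 R) : (jacobian φ).det =
    pderiv 0 (coord φ 0) * pderiv 1 (coord φ 1) - pderiv 1 (coord φ 0) * pderiv 0 (coord φ 1) := by
  rw [Matrix.det_fin_two]
  rfl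

/-- The theorem of Jung and van der Kulk for special automorphisms of the plane. -/
theorem SA_two_le_EA_two : SA 2 k ≤ EA 2 k := by
  suffices h : ∀ (N : ℕ) (φ : GA 2 k), φ ∈ SA 2 k →
      (coord φ 0).totalDegree + (coord φ 1).totalDegree ≤ N → φ ∈ EA 2 k from
    fun φ hφ => h _ φ hφ le_rfl
  intro N
  induction N using Nat.strong_induction_on with
  | _ N ih =>
    intro φ hφ hN
    have hdet : pderiv 0 (coord φ 0) * pderiv 1 (coord φ 1) -
        pderiv 1 (coord φ 0) * pderiv 0 (coord φ 1) = 1 := by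
      rw [← det_jacobian_two]
      exact hφ
    have h0 : 0 < (coord φ 0).totalDegree := by
      by_contra h
      rw [not_lt, Nat.le_zero, totalDegree_eq_zero_iff_eq_C] at h
      rw [h] at hdet
      simp at hdet
    have h1 : 0 < (coord φ 1).totalDegree := by
      by_contra h
      rw [not_lt, Nat.le_zero, totalDegree_eq_zero_iff_eq_C] at h
      rw [h] at hdet
      simp at hdet
    have step : ∀ {i j : Fin 2} (hij : i ≠ j) (a : ℕ) (μ : k),
        (coord φ j - C μ * coord φ i ^ a).totalDegree < (coord φ j).totalDegree → φ ∈ EA 2 k := by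
      intro i j hij a μ hlt
      refine mem_EA_of_shear_mul_mem hij (Polynomial.C (-μ) * Polynomial.X ^ a) ?_
      refine ih _ ?_ _ ((SA 2 k).mul_mem (EA_le_SA (shear_mem_EA _ _)) hφ) le_rfl
      have e : Polynomial.aeval (coord φ i) (Polynomial.C (-μ) * Polynomial.X ^ a) =
          -(C μ * coord φ i ^ a) := by
        simp [← algebraMap_eq]
      simp only [coord_shear_mul, e, ← sub_eq_add_neg]
      refine lt_of_lt_of_le ?_ hN
      have hcases : i = 0 ∧ j = 1 ∨ i = 1 ∧ j = 0 := by
        fin_cases i <;> fin_cases j <;> simp_all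
      rcases hcases with ⟨rfl, rfl⟩ | ⟨rfl, rfl⟩
      · rw [if_neg (by decide), if_pos rfl]
        omega
      · rw [if_pos rfl, if_neg (by decide)]
        omega
    rcases le_total (coord φ 0).totalDegree (coord φ 1).totalDegree with hle | hle
    · by_cases h2 : 2 ≤ (coord φ 1).totalDegree
      · obtain ⟨a, μ, h⟩ := exists_degree_reduction (by rw [hdet, map_one])
          (X_mem_adjoin_coord φ) h0 hle h2
        exact step (by decide) a μ h
      · obtain ⟨a, b, e, h3⟩ := eq_affine_of_totalDegree_le_one (p := coord φ 0) (by omega)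
        obtain ⟨c, d, f, h4⟩ := eq_affine_of_totalDegree_le_one (p := coord φ 1) (by omega)
        refine mem_EA_of_affine h3 h4 ?_
        rw [h3, h4] at hdet
        apply C_injective (Fin 2) k
        simpa [pderiv_X, Pi.single_apply] using hdet
    · by_cases h2 : 2 ≤ (coord φ 0).totalDegree
      · obtain ⟨a, μ, h⟩ := exists_degree_reduction (F := coord φ 1) (G := coord φ 0)
          (by
            -- Swapping the coordinates turns the Jacobian into `-1`, which has the same degree.
            rw [← map_one (degVal (Fin 2) k), ← hdet, ← Valuation.map_neg]
            congr 1
            ring)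
          (fun i => by rw [Set.pair_comm]; exact X_mem_adjoin_coord φ i) h1 hle h2
        exact step (by decide) a μ h
      · obtain ⟨a, b, e, h3⟩ := eq_affine_of_totalDegree_le_one (p := coord φ 0) (by omega)
        obtain ⟨c, d, f, h4⟩ := eq_affine_of_totalDegree_le_one (p := coord φ 1) (by omega)
        refine mem_EA_of_affine h3 h4 ?_
        rw [h3, h4] at hdet
        apply C_injective (Fin 2) k
        simpa [pderiv_X, Pi.single_apply] using hdet

end Jung

end PolyAut

end

noncomputable section

namespace PolyAut

/-! ### Change of rings, lifting of elementary products, stabilization -/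

section Functoriality

open MvPolynomial

variable {n : ℕ} {R S T : Type*} [CommRing R] [CommRing S] [CommRing T]

/-- The automorphism obtained by applying a ring homomorphism to all coefficients. -/
def mapGAFun (f : R →+* S) (φ : GA n R) : GA n S :=
  ofVector (fun i => map f (coord φ i)) (fun i => map f (coord φ⁻¹ i))
    (fun i => by
      rw [← map_bind₁, ← coord_mul, mul_inv_cancel, coord_one, map_X])
    (fun i => by
      rw [← map_bind₁, ← coord_mul, inv_mul_cancel, coord_one, map_X])

theorem coord_mapGAFun (f : R →+* S) (φ : GA n R) :
    coord (mapGAFun f φ) = fun i => map f (coord φ i) := by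
  funext i
  rw [mapGAFun, coord_ofVector]

/-- The homomorphism `GA_n(R) → GA_n(S)` induced by a ring homomorphism. -/
def mapGA (f : R →+* S) : GA n R →* GA n S where
  toFun := mapGAFun f
  map_one' := ext_coord fun i => by simp [coord_mapGAFun]
  map_mul' φ ψ := ext_coord fun i => by
    simp only [coord_mul, coord_mapGAFun, map_bind₁]

theorem coord_mapGA (f : R →+* S) (φ : GA n R) (i : Fin n) :
    coord (mapGA f φ) i = map f (coord φ i) :=
  congrFun (coord_mapGAFun f φ) i

theorem mapGA_mapGA (f : R →+* S) (g : S →+* T) (φ : GA n R) :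
    mapGA g (mapGA f φ) = mapGA (g.comp f) φ :=
  ext_coord fun i => by simp only [coord_mapGA, map_map]

theorem mapGA_eq_of_ker_le (f : R →+* S) (g : R →+* T) (h : RingHom.ker f ≤ RingHom.ker g)
    {φ ψ : GA n R} (hφ : mapGA f φ = mapGA f ψ) : mapGA g φ = mapGA g ψ := by
  refine ext_coord fun i => ?_
  have h1 := congrArg (fun χ => coord χ i) hφ
  simp only [coord_mapGA] at h1 ⊢
  ext s
  have h2 := congrArg (coeff s) h1
  rw [coeff_map, coeff_map, ← sub_eq_zero, ← map_sub] at h2 ⊢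
  exact h h2

theorem coord_sub_mem_of_mapGA_eq_one {I : Ideal R} {φ : GA n R}
    (h : mapGA (Ideal.Quotient.mk I) φ = 1) (i : Fin n) : coord φ i - X i ∈ I.map C := by
  have h1 := congrArg (fun χ => coord χ i) h
  simp only [coord_mapGA, coord_one] at h1
  rw [mem_map_C_iff]
  intro s
  have h2 := congrArg (coeff s) h1
  rw [← map_X (Ideal.Quotient.mk I), coeff_map, coeff_map, ← sub_eq_zero, ← map_sub] at h2
  rw [coeff_sub]
  exact Ideal.Quotient.eq_zero_iff_mem.1 h2

theorem map_mem_supported (f : R →+* S) {s : Set (Fin n)} {p : MvPolynomial (Fin n) R}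
    (hp : p ∈ supported R s) : map f p ∈ supported S s := by
  rw [supported_eq_range_rename] at hp ⊢
  obtain ⟨q, rfl⟩ := hp
  exact ⟨map f q, (map_rename _ _ _).symm⟩

theorem mapGA_elementary (f : R →+* S) (i : Fin n) (p : supported R ({i}ᶜ : Set (Fin n))) :
    mapGA f (elementary i p) = elementary i ⟨map f p, map_mem_supported f p.2⟩ :=
  ext_coord fun j => by
    rw [coord_mapGA, coord_elementary, coord_elementary]
    split_ifs <;> simp

theorem mapGA_mem_EA (f : R →+* S) {φ : GA n R} (hφ : φ ∈ EA n R) : mapGA f φ ∈ EA n S := by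
  have : EA n R ≤ (EA n S).comap (mapGA f) := by
    refine (Subgroup.closure_le _).2 ?_
    rintro _ ⟨i, p, rfl⟩
    change mapGA f _ ∈ EA n S
    rw [mapGA_elementary]
    exact elementary_mem_EA _ _
  exact this hφ

theorem mapGA_mem_SA (f : R →+* S) {φ : GA n R} (hφ : φ ∈ SA n R) : mapGA f φ ∈ SA n S := by
  have h : jacobian (mapGA f φ) = (jacobian φ).map (map f) := by
    ext1 i j
    simp only [jacobian, Matrix.of_apply, Matrix.map_apply, coord_mapGA, pderiv_map]
  change (jacobian (mapGA f φ)).det = 1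
  rw [h, ← RingHom.mapMatrix_apply, ← RingHom.map_det, show (jacobian φ).det = 1 from hφ, map_one]

theorem coord_stab (m : ℕ) (φ : GA n R) : coord (stab m φ) = stabVector m (coord φ) :=
  coord_stabFun m φ

theorem mapGA_stab (f : R →+* S) (m : ℕ) (φ : GA n R) :
    mapGA f (stab m φ) = stab m (mapGA f φ) := by
  refine ext_coord fun i => ?_
  rw [coord_mapGA, coord_stab, coord_stab]
  refine Fin.addCases (fun i => ?_) (fun j => ?_) i
  · simp [stabVector, coord_mapGA, map_rename]
  · simp [stabVector]

/-- Elementary products lift along a surjection `f`; if `f e = 1` the lift can be chosen with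
trivial image under every homomorphism that kills `e`. -/
theorem exists_lift_EA {R : Type*} {S : Type*} [CommRing R] [CommRing S] {f : R →+* S}
    (hf : Function.Surjective f) {e : R} (he : f e = 1) {ψ : GA n S} (hψ : ψ ∈ EA n S) :
    ∃ φ ∈ EA n R, mapGA f φ = ψ ∧
      ∀ I : Ideal R, e ∈ I → mapGA (Ideal.Quotient.mk I) φ = 1 := by
  induction hψ using Subgroup.closure_induction with
  | mem x hx =>
    obtain ⟨i, ⟨p, hp⟩, rfl⟩ := hx
    rw [supported_eq_range_rename] at hp
    obtain ⟨q, rfl⟩ := hp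
    obtain ⟨q', rfl⟩ := map_surjective f hf q
    have hmem : C e * rename (Subtype.val : ({i}ᶜ : Set (Fin n)) → Fin n) q' ∈
        supported R ({i}ᶜ : Set (Fin n)) := by
      refine mul_mem (Subalgebra.algebraMap_mem _ e) ?_
      rw [supported_eq_range_rename]
      exact ⟨q', rfl⟩
    refine ⟨elementary i ⟨_, hmem⟩, elementary_mem_EA _ _, ?_, fun I hI => ?_⟩
    · rw [mapGA_elementary]
      congr 1
      apply Subtype.ext
      change map f (C e * rename _ q') = rename _ (map f q')
      rw [map_mul, map_C, he, map_one, one_mul, map_rename]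
    · refine ext_coord fun j => ?_
      rw [coord_mapGA, coord_elementary, coord_one]
      split_ifs with h
      · have h0 : Ideal.Quotient.mk I e = 0 := Ideal.Quotient.eq_zero_iff_mem.2 hI
        simp [h0, h]
      · simp
  | one => exact ⟨1, one_mem _, map_one _, fun I _ => map_one _⟩
  | mul x y _ _ hx hy =>
    obtain ⟨φ, hφ, h1, h2⟩ := hx
    obtain ⟨ψ, hψ, h3, h4⟩ := hy
    exact ⟨φ * ψ, mul_mem hφ hψ, by rw [map_mul, h1, h3],
      fun I hI => by rw [map_mul, h2 I hI, h4 I hI, one_mul]⟩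
  | inv x _ hx =>
    obtain ⟨φ, hφ, h1, h2⟩ := hx
    exact ⟨φ⁻¹, inv_mem hφ, by rw [map_inv, h1], fun I hI => by rw [map_inv, h2 I hI, inv_one]⟩

theorem rename_mem_supported {σ τ : Type*} (f : σ → τ) {s : Set σ} {t : Set τ}
    {p : MvPolynomial σ R} (hp : p ∈ supported R s) (h : Set.MapsTo f s t) :
    rename f p ∈ supported R t := by
  rw [mem_supported] at hp ⊢
  intro a ha
  classical
  obtain ⟨b, hb, rfl⟩ := Finset.mem_image.1 (vars_rename f p ha)
  exact h (hp hb)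

theorem stab_mem_EA (m : ℕ) {φ : GA n R} (hφ : φ ∈ EA n R) : stab m φ ∈ EA (n + m) R := by
  have : EA n R ≤ (EA (n + m) R).comap (stab m) := by
    refine (Subgroup.closure_le _).2 ?_
    rintro _ ⟨i, ⟨p, hp⟩, rfl⟩
    have hmem : rename (Fin.castAdd m) p ∈ supported R ({Fin.castAdd m i}ᶜ : Set (Fin (n + m))) :=
      rename_mem_supported _ hp fun j hj => by simpa using hj
    have h : stab m (elementary i ⟨p, hp⟩) = elementary (Fin.castAdd m i) ⟨_, hmem⟩ := by
      refine ext_coord fun j => ?_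
      rw [coord_stab, coord_elementary]
      refine Fin.addCases (fun j => ?_) (fun j => ?_) j
      · simp only [stabVector, Fin.append_left, coord_elementary, Fin.castAdd_inj]
        split_ifs <;> simp
      · rw [if_neg]
        · simp [stabVector]
        · intro h
          have := congrArg Fin.val h
          simp at this
          omega
    change stab m _ ∈ EA (n + m) R
    rw [h]
    exact elementary_mem_EA _ _
  exact this hφ

theorem stab_mem_SA (m : ℕ) {φ : GA n R} (hφ : φ ∈ SA n R) : stab m φ ∈ SA (n + m) R := by
  have hinj : Function.Injective (Fin.castAdd m : Fin n → Fin (n + m)) := Fin.castAdd_injective n m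
  have h : jacobian (stab m φ) = Matrix.reindex finSumFinEquiv finSumFinEquiv
      (Matrix.fromBlocks ((jacobian φ).map (rename (Fin.castAdd m))) 0 0 1) := by
    ext1 i j
    rw [jacobian, Matrix.of_apply, coord_stab, Matrix.reindex_apply, Matrix.submatrix_apply]
    refine Fin.addCases (fun i => ?_) (fun i => ?_) i <;>
      refine Fin.addCases (fun j => ?_) (fun j => ?_) j
    · simp [stabVector, pderiv_rename hinj, jacobian]
    · simp only [stabVector, Fin.append_left, finSumFinEquiv_symm_apply_castAdd,
        finSumFinEquiv_symm_apply_natAdd, Matrix.fromBlocks_apply₁₂, Matrix.zero_apply]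
      refine pderiv_eq_zero_of_notMem_vars fun hmem => ?_
      obtain ⟨a, -, ha⟩ := Finset.mem_image.1 (vars_rename _ _ hmem)
      have := congrArg Fin.val ha
      simp at this
      omega
    · have hne : Fin.natAdd n i ≠ Fin.castAdd m j := by
        intro h
        have := congrArg Fin.val h
        simp at this
        omega
      simp [stabVector, pderiv_X, hne]
    · simp [stabVector, pderiv_X, Pi.single_apply, Matrix.one_apply]
  change (jacobian (stab m φ)).det = 1
  rw [h, Matrix.det_reindex_self, Matrix.det_fromBlocks_zero₂₁, Matrix.det_one, mul_one]
  have := RingHom.map_det (rename (R := R) (Fin.castAdd m : Fin n → Fin (n + m))).toRingHom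
    (jacobian φ)
  rw [show (jacobian φ).det = 1 from hφ, map_one] at this
  exact this.symm

end Functoriality

end PolyAut

end

noncomputable section

namespace PolyAut

/-! ### Infinitesimal automorphisms over a square-zero ideal -/

section SquareZero

/-- A nontrivial permutation moves both some `i` and its image, giving two off-diagonal factors with
product zero; the diagonal product keeps only its linear part. -/
theorem det_one_add_of_mul_eq_zero {ι B : Type*} [Fintype ι] [DecidableEq ι] [CommRing B]
    (M : Matrix ι ι B) (hM : ∀ i j k l, M i j * M k l = 0) : (1 + M).det = 1 + M.trace := by
  have hprod : ∀ s : Finset ι, ∏ i ∈ s, (1 + M i i) = 1 + ∑ i ∈ s, M i i := by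
    intro s
    induction s using Finset.induction_on with
    | empty => simp
    | insert a s ha ih =>
      have h0 : M a a * ∑ i ∈ s, M i i = 0 := by
        rw [Finset.mul_sum]
        exact Finset.sum_eq_zero fun i _ => hM a a i i
      rw [Finset.prod_insert ha, Finset.sum_insert ha, ih]
      linear_combination h0
  rw [Matrix.det_apply, Finset.sum_eq_single 1]
  · simp only [Equiv.Perm.sign_one, one_smul, Equiv.Perm.one_apply, Matrix.add_apply,
      Matrix.one_apply_eq]
    exact hprod _
  · intro σ _ hσ
    obtain ⟨i, hi⟩ : ∃ i, σ i ≠ i := by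
      by_contra! h
      exact hσ (Equiv.ext h)
    have hi' : σ (σ i) ≠ σ i := fun h => hi (σ.injective h)
    rw [← Finset.mul_prod_erase _ _ (Finset.mem_univ i),
      ← Finset.mul_prod_erase _ _ (Finset.mem_erase.2 ⟨hi, Finset.mem_univ (σ i)⟩), ← mul_assoc,
      Matrix.add_apply, Matrix.add_apply, Matrix.one_apply_ne hi, Matrix.one_apply_ne hi',
      zero_add, zero_add, hM, zero_mul, smul_zero]
  · simp

open MvPolynomial

variable {n : ℕ} {A : Type*} [CommRing A] {J : Ideal A}

theorem mul_eq_zero_of_mem_map_C (hJ : J * J = ⊥) {p q : MvPolynomial (Fin n) A}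
    (hp : p ∈ J.map C) (hq : q ∈ J.map C) : p * q = 0 := by
  have h := Ideal.mul_mem_mul hp hq
  rwa [← Ideal.map_mul, hJ, Ideal.map_bot, Ideal.mem_bot] at h

theorem pderiv_mem_map_C {p : MvPolynomial (Fin n) A} (hp : p ∈ J.map C) (i : Fin n) :
    pderiv i p ∈ J.map C := by
  induction hp using Submodule.span_induction with
  | mem x hx =>
    obtain ⟨a, -, rfl⟩ := hx
    simp
  | zero => simp
  | add x y _ _ hx hy => rw [map_add]; exact add_mem hx hy
  | smul a x hx' hx =>
    rw [smul_eq_mul, Derivation.leibniz]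
    exact add_mem (Ideal.mul_mem_left _ _ hx) (Ideal.mul_mem_right _ _ hx')

/-- Taylor expansion to first order, which is exact for a square-zero increment. -/
theorem bind₁_X_add (hJ : J * J = ⊥) {h : Fin n → MvPolynomial (Fin n) A}
    (hh : ∀ i, h i ∈ J.map C) (p : MvPolynomial (Fin n) A) :
    bind₁ (fun i => X i + h i) p = p + ∑ j, pderiv j p * h j := by
  induction p using MvPolynomial.induction_on with
  | C a => simp
  | add p q hp hq => simp only [map_add, hp, hq, add_mul, Finset.sum_add_distrib]; ring
  | mul_X p i hp =>
    have h0 : (∑ j, pderiv j p * h j) * h i = 0 := by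
      rw [Finset.sum_mul]
      exact Finset.sum_eq_zero fun j _ => by
        rw [mul_assoc, mul_eq_zero_of_mem_map_C hJ (hh j) (hh i), mul_zero]
    have h1 : ∑ j, pderiv j (p * X i) * h j = p * h i + X i * ∑ j, pderiv j p * h j := by
      rw [Finset.mul_sum]
      simp only [Derivation.leibniz, smul_eq_mul, pderiv_X, add_mul, Finset.sum_add_distrib]
      congr 1
      · rw [Finset.sum_eq_single i]
        · simp
        · intro b _ hb
          simp [hb.symm]
        · simp
      · exact Finset.sum_congr rfl fun k _ => by ring
    rw [map_mul, hp, bind₁_X_right, h1]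
    linear_combination h0

/-- This makes composition of automorphisms congruent to the identity mod `J` additive. -/
theorem bind₁_X_add_of_mem (hJ : J * J = ⊥) {h : Fin n → MvPolynomial (Fin n) A}
    (hh : ∀ i, h i ∈ J.map C) {p : MvPolynomial (Fin n) A} (hp : p ∈ J.map C) :
    bind₁ (fun i => X i + h i) p = p := by
  rw [bind₁_X_add hJ hh, Finset.sum_eq_zero fun j _ =>
    mul_eq_zero_of_mem_map_C hJ (pderiv_mem_map_C hp j) (hh j), add_zero]

theorem sum_pderiv_eq_zero_of_mem_SA (hJ : J * J = ⊥) {h : Fin n → MvPolynomial (Fin n) A}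
    (hh : ∀ i, h i ∈ J.map C) {φ : GA n A} (hφ : φ ∈ SA n A) (hc : ∀ i, coord φ i = X i + h i) :
    ∑ i, pderiv i (h i) = 0 := by
  have h1 : jacobian φ = 1 + Matrix.of fun i j => pderiv j (h i) := by
    ext1 i j
    simp [jacobian, hc, pderiv_X, Matrix.one_apply, Pi.single_apply]
  have h2 : (jacobian φ).det = 1 := hφ
  rw [h1, det_one_add_of_mul_eq_zero] at h2
  · simpa [Matrix.trace] using h2
  · exact fun i j k l =>
      mul_eq_zero_of_mem_map_C hJ (pderiv_mem_map_C (hh i) j) (pderiv_mem_map_C (hh k) l)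

/-- The vector fields `h` with coefficients in the square-zero ideal `J` for which `X + h` is a
composition of elementary automorphisms. -/
def infinitesimalEA (n : ℕ) (hJ : J * J = ⊥) : AddSubmonoid (Fin n → MvPolynomial (Fin n) A) where
  carrier := {h | (∀ i, h i ∈ J.map C) ∧ ∃ φ ∈ EA n A, ∀ i, coord φ i = X i + h i}
  zero_mem' := ⟨fun i => zero_mem _, 1, one_mem _, fun i => by simp⟩
  add_mem' := by
    rintro h h' ⟨hh, φ, hφ, hc⟩ ⟨hh', ψ, hψ, hc'⟩
    refine ⟨fun i => add_mem (hh i) (hh' i), φ * ψ, mul_mem hφ hψ, fun i => ?_⟩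
    rw [coord_mul, hc, show coord ψ = fun i => X i + h' i from funext hc', map_add,
      bind₁_X_right, bind₁_X_add_of_mem hJ hh' (hh i), Pi.add_apply]
    ring

/-- The vector fields all of whose multiples by elements of `J` integrate to compositions of
elementary automorphisms. -/
def tangentEA (n : ℕ) (hJ : J * J = ⊥) : Submodule A (Fin n → MvPolynomial (Fin n) A) where
  carrier := {H | ∀ a ∈ J, a • H ∈ infinitesimalEA n hJ}
  zero_mem' a _ := by rw [smul_zero]; exact zero_mem _
  add_mem' hH hH' a ha := by rw [smul_add]; exact add_mem (hH a ha) (hH' a ha)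
  smul_mem' r H hH a ha := by rw [smul_smul]; exact hH _ (Ideal.mul_mem_right _ _ ha)

theorem mem_infinitesimalEA_of_coord (hJ : J * J = ⊥) {h : Fin n → MvPolynomial (Fin n) A}
    (hh : ∀ i, h i ∈ J.map C) {φ : GA n A} (hφ : φ ∈ EA n A) (hc : ∀ i, coord φ i = X i + h i) :
    h ∈ infinitesimalEA n hJ := ⟨hh, φ, hφ, hc⟩

theorem mem_tangentEA_iff (hJ : J * J = ⊥) {H : Fin n → MvPolynomial (Fin n) A} :
    H ∈ tangentEA n hJ ↔ ∀ a ∈ J, a • H ∈ infinitesimalEA n hJ := Iff.rfl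

/-- Passing to `tangentEA` separates the coefficients, which lie in `J`, from the monomials, so only
finitely many monomial fields need to be integrated. -/
theorem map_mem_infinitesimalEA {m : ℕ} (hJ : J * J = ⊥)
    (L : MvPolynomial (Fin m) A →ₗ[A] (Fin n → MvPolynomial (Fin n) A))
    (hL : ∀ s, L (monomial s 1) ∈ tangentEA n hJ) {p : MvPolynomial (Fin m) A}
    (hp : p ∈ J.map C) : L p ∈ infinitesimalEA n hJ := by
  rw [mem_map_C_iff] at hp
  rw [p.as_sum, map_sum]
  refine sum_mem fun s _ => ?_
  rw [← mul_one (coeff s p), ← smul_eq_mul, ← smul_monomial, map_smul]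
  exact hL s _ (hp s)

theorem smul_mem_map_C {a : A} (ha : a ∈ J) (p : MvPolynomial (Fin n) A) : a • p ∈ J.map C := by
  rw [smul_eq_C_mul]
  exact Ideal.mul_mem_right _ _ (Ideal.mem_map_of_mem _ ha)

theorem single_mem_tangentEA (hJ : J * J = ⊥) {i : Fin n} {f : MvPolynomial (Fin n) A}
    (hf : f ∈ supported A ({i}ᶜ : Set (Fin n))) :
    (Pi.single i f : Fin n → MvPolynomial (Fin n) A) ∈ tangentEA n hJ := by
  intro a ha
  refine ⟨fun j => smul_mem_map_C ha _, elementary i ⟨a • f, Subalgebra.smul_mem _ hf a⟩,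
    elementary_mem_EA _ _, fun j => ?_⟩
  rw [coord_elementary]
  split_ifs with h
  · subst h; simp
  · simp [h]

theorem elementary_inv (i : Fin n) (f : supported A ({i}ᶜ : Set (Fin n))) :
    (elementary i f)⁻¹ = elementary i (-f) := by
  rw [inv_eq_iff_mul_eq_one]
  refine ext_coord fun j => ?_
  rw [coord_mul, coord_elementary, coord_one]
  split_ifs with h
  · rw [map_add, bind₁_X_right, coord_elementary, if_pos rfl,
      bind₁_eq_self_of_mem_supported (i := i) (fun k hk => by rw [coord_elementary, if_neg hk]) f.2,
      h]
    simp
  · rw [bind₁_X_right, coord_elementary, if_neg h]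

/-- First-order Taylor expansion of the inverse elementary map along `h`; the correction to the
`l`-th component is the derivative of `f` along `h`. -/
theorem coord_conj_elementary (hJ : J * J = ⊥) {h : Fin n → MvPolynomial (Fin n) A}
    (hh : ∀ i, h i ∈ J.map C) {φ : GA n A} (hc : ∀ i, coord φ i = X i + h i) (l : Fin n)
    (f : supported A ({l}ᶜ : Set (Fin n))) (i : Fin n) :
    coord ((elementary l f)⁻¹ * φ * elementary l f) i =
      X i + bind₁ (coord (elementary l f))
        (h i - if i = l then ∑ j, pderiv j (f : MvPolynomial (Fin n) A) * h j else 0) := by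
  have hinv : bind₁ (coord (elementary l f)) (coord (elementary l f)⁻¹ i) = X i := by
    rw [← coord_mul, inv_mul_cancel, coord_one]
  have hsum : ∀ g : Fin n → MvPolynomial (Fin n) A,
      ∑ j, pderiv j (X i : MvPolynomial (Fin n) A) * g j = g i := by
    intro g
    rw [Finset.sum_eq_single i]
    · simp
    · intro b _ hb
      simp [hb.symm]
    · simp
  rw [coord_mul, coord_mul, show coord φ = fun i => X i + h i from funext hc,
    bind₁_X_add hJ hh, map_add, hinv]
  congr 2
  rw [elementary_inv, coord_elementary]
  split_ifs with hi
  · subst hi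
    simp only [NegMemClass.coe_neg, map_add, map_neg, add_mul, neg_mul, Finset.sum_add_distrib,
      Finset.sum_neg_distrib, hsum]
    ring
  · rw [hsum, sub_zero]

/-- The adjoint action of `elementary l f` on vector fields. -/
def adjointElementary (l : Fin n) (f : supported A ({l}ᶜ : Set (Fin n)))
    (H : Fin n → MvPolynomial (Fin n) A) (i : Fin n) : MvPolynomial (Fin n) A :=
  bind₁ (coord (elementary l f))
    (H i - if i = l then ∑ j, pderiv j (f : MvPolynomial (Fin n) A) * H j else 0)

theorem adjointElementary_smul (l : Fin n) (f : supported A ({l}ᶜ : Set (Fin n))) (a : A)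
    (H : Fin n → MvPolynomial (Fin n) A) :
    adjointElementary l f (a • H) = a • adjointElementary l f H := by
  funext i
  rw [Pi.smul_apply, adjointElementary, adjointElementary, ← map_smul]
  congr 1
  split_ifs
  · simp only [Pi.smul_apply, smul_sub, Finset.smul_sum, mul_smul_comm]
  · simp

theorem adjointElementary_sub (l : Fin n) (f : supported A ({l}ᶜ : Set (Fin n)))
    (H H' : Fin n → MvPolynomial (Fin n) A) :
    adjointElementary l f (H - H') = adjointElementary l f H - adjointElementary l f H' := by
  funext i
  rw [Pi.sub_apply, adjointElementary, adjointElementary, adjointElementary, ← map_sub]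
  congr 1
  split_ifs
  · simp only [Pi.sub_apply, mul_sub, Finset.sum_sub_distrib]
    ring
  · simp

theorem adjointElementary_single (l : Fin n) (f : supported A ({l}ᶜ : Set (Fin n))) (j : Fin n)
    (g : MvPolynomial (Fin n) A) :
    adjointElementary l f (Pi.single j g) = Pi.single j (bind₁ (coord (elementary l f)) g) -
      Pi.single l (bind₁ (coord (elementary l f)) (pderiv j (f : MvPolynomial (Fin n) A) * g)) := by
  funext i
  have h : ∑ k, pderiv k (f : MvPolynomial (Fin n) A) *
      (Pi.single j g : Fin n → MvPolynomial (Fin n) A) k = pderiv j (f : MvPolynomial (Fin n) A) * g := by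
    rw [Finset.sum_eq_single j]
    · simp
    · intro b _ hb
      simp [hb]
    · simp
  rw [adjointElementary, h, map_sub, Pi.sub_apply]
  congr 1
  · rw [Pi.single_apply, Pi.single_apply]
    split_ifs <;> simp
  · rw [Pi.single_apply]
    split_ifs <;> simp

/-- `tangentEA` is stable under the adjoint action of elementary automorphisms. -/
theorem adjointElementary_mem_tangentEA (hJ : J * J = ⊥) {H : Fin n → MvPolynomial (Fin n) A}
    (hH : H ∈ tangentEA n hJ) (l : Fin n) (f : supported A ({l}ᶜ : Set (Fin n))) :
    adjointElementary l f H ∈ tangentEA n hJ := by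
  rw [mem_tangentEA_iff] at hH ⊢
  intro a ha
  obtain ⟨hh, φ, hφ, hc⟩ := hH a ha
  refine mem_infinitesimalEA_of_coord hJ (fun j => smul_mem_map_C ha _)
    (mul_mem (mul_mem (inv_mem (elementary_mem_EA l f)) hφ) (elementary_mem_EA l f))
    fun i => ?_
  rw [coord_conj_elementary hJ hh hc, ← adjointElementary_smul]
  rfl

theorem bind₁_coord_elementary_of_mem_supported {l : Fin n}
    (f : supported A ({l}ᶜ : Set (Fin n))) {g : MvPolynomial (Fin n) A}
    (hg : g ∈ supported A ({l}ᶜ : Set (Fin n))) : bind₁ (coord (elementary l f)) g = g :=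
  bind₁_eq_self_of_mem_supported (i := l) (fun k hk => by rw [coord_elementary, if_neg hk]) hg

theorem X_mem_supported_compl {i j : Fin n} (h : i ≠ j) :
    (X i : MvPolynomial (Fin n) A) ∈ supported A ({j}ᶜ : Set (Fin n)) :=
  Algebra.subset_adjoin ⟨i, h, rfl⟩

/-- As in `sl_2`, the diagonal field comes from the two nilpotent ones: conjugating `f X_i ∂_j` by
`X_i ↦ X_i + X_j` produces it, up to sign, together with off-diagonal fields already available. -/
theorem single_X_sub_single_X_mem_tangentEA (hJ : J * J = ⊥) {i j : Fin n} (hij : i ≠ j)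
    {f : MvPolynomial (Fin n) A} (hi : f ∈ supported A ({i}ᶜ : Set (Fin n)))
    (hj : f ∈ supported A ({j}ᶜ : Set (Fin n))) :
    (Pi.single i (f * X i) - Pi.single j (f * X j) : Fin n → MvPolynomial (Fin n) A) ∈
      tangentEA n hJ := by
  have h1 := single_mem_tangentEA hJ (mul_mem hj (X_mem_supported_compl hij))
  have h2 := single_mem_tangentEA hJ (mul_mem hi (X_mem_supported_compl hij.symm))
  have h3 := adjointElementary_mem_tangentEA hJ h1 i ⟨X j, X_mem_supported_compl hij.symm⟩
  rw [adjointElementary_single, pderiv_X_self, one_mul, map_mul,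
    bind₁_coord_elementary_of_mem_supported _ hi, bind₁_X_right, coord_elementary, if_pos rfl] at h3
  have h4 := sub_mem (sub_mem h1 h3) h2
  convert h4 using 1
  simp only [mul_add, Pi.single_add]
  abel

theorem pderiv_X_pow_mul_X {i : Fin n} (m : ℕ) :
    pderiv i (X i ^ m : MvPolynomial (Fin n) A) * X i = (m : MvPolynomial (Fin n) A) * X i ^ m := by
  rw [Derivation.leibniz_pow, pderiv_X_self]
  cases m with
  | zero => simp
  | succ m => simp [pow_succ]; ring

/-- The auxiliary variable `y` raises the power of `x`: conjugating `g y (x ∂_x - z ∂_z)` by `y ↦ y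
+ x ^ m` creates `g x ^ m (x ∂_x - z ∂_z)`. The by-products are a multiple of `x ^ (2m) ∂_y`, which
is elementary, and `-m g x ^ m y ∂_y`, which is traded for the same multiple of `z ∂_z` by a
diagonal field. -/
theorem single_pow_sub_mem_tangentEA (hJ : J * J = ⊥) {x y z : Fin n} (hxy : x ≠ y) (hxz : x ≠ z)
    (hyz : y ≠ z) {g : MvPolynomial (Fin n) A} (hx : g ∈ supported A ({x}ᶜ : Set (Fin n)))
    (hy : g ∈ supported A ({y}ᶜ : Set (Fin n))) (hz : g ∈ supported A ({z}ᶜ : Set (Fin n)))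
    (k : ℕ) :
    (Pi.single x (g * X x ^ k) - Pi.single z (g * pderiv x (X x ^ k) * X z) :
      Fin n → MvPolynomial (Fin n) A) ∈ tangentEA n hJ := by
  cases k with
  | zero => simpa using single_mem_tangentEA hJ hx
  | succ m =>
    have hX := pow_mem (X_mem_supported_compl (A := A) hxy) m
    have hX' := pow_mem (X_mem_supported_compl (A := A) hxz) m
    have h1 := single_X_sub_single_X_mem_tangentEA hJ hxz
      (mul_mem hx (X_mem_supported_compl hxy.symm)) (mul_mem hz (X_mem_supported_compl hyz))
    have h2 := adjointElementary_mem_tangentEA hJ h1 y ⟨X x ^ m, hX⟩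
    have h3 : (Pi.single y (g * ((m : MvPolynomial (Fin n) A) * X x ^ (m + m))) : Fin n → MvPolynomial (Fin n) A) ∈
        tangentEA n hJ := by
      refine single_mem_tangentEA hJ (mul_mem hy (mul_mem (natCast_mem _ _) ?_))
      rw [pow_add]
      exact mul_mem hX hX
    have h4 := single_X_sub_single_X_mem_tangentEA hJ hyz
      (mul_mem (mul_mem hy hX) (natCast_mem _ m)) (mul_mem (mul_mem hz hX') (natCast_mem _ m))
    have hdz : pderiv z (X x ^ m : MvPolynomial (Fin n) A) = 0 :=
      pderiv_eq_zero_of_mem_supported hX'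
    have e1 : bind₁ (coord (elementary y ⟨X x ^ m, hX⟩)) (g * X y * X x) =
        g * X y * X x + g * X x ^ (m + 1) := by
      rw [map_mul, map_mul, bind₁_coord_elementary_of_mem_supported _ hy, bind₁_X_right,
        bind₁_X_right, coord_elementary, coord_elementary, if_pos rfl, if_neg hxy]
      ring
    have e2 : bind₁ (coord (elementary y ⟨X x ^ m, hX⟩)) (g * X y * X z) =
        g * X y * X z + g * X x ^ m * X z := by
      rw [map_mul, map_mul, bind₁_coord_elementary_of_mem_supported _ hy, bind₁_X_right,
        bind₁_X_right, coord_elementary, coord_elementary, if_pos rfl, if_neg hyz.symm]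
      ring
    have e3 : bind₁ (coord (elementary y ⟨X x ^ m, hX⟩))
        (pderiv x (X x ^ m) * (g * X y * X x)) =
        g * X x ^ m * (m : MvPolynomial (Fin n) A) * X y + g * ((m : MvPolynomial (Fin n) A) * X x ^ (m + m)) := by
      rw [show pderiv x (X x ^ m) * (g * X y * X x) =
          g * X y * ((m : MvPolynomial (Fin n) A) * X x ^ m) by rw [← pderiv_X_pow_mul_X]; ring,
        map_mul, map_mul, map_mul, map_pow, map_natCast,
        bind₁_coord_elementary_of_mem_supported _ hy, bind₁_X_right,
        bind₁_X_right, coord_elementary, coord_elementary, if_pos rfl, if_neg hxy]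
      ring
    rw [adjointElementary_sub, adjointElementary_single, adjointElementary_single] at h2
    simp only [hdz, zero_mul, map_zero, Pi.single_zero, sub_zero, e1, e2, e3] at h2
    have h5 := add_mem (add_mem (sub_mem h2 h1) h3) h4
    convert h5 using 1
    have e4 : g * pderiv x (X x ^ (m + 1)) * X z =
        g * X x ^ m * X z + g * X x ^ m * (m : MvPolynomial (Fin n) A) * X z := by
      rw [Derivation.leibniz_pow, pderiv_X_self]
      simp
      ring
    rw [e4]
    simp only [Pi.single_add]
    abel

end SquareZero

end PolyAut

end

noncomputable section

namespace PolyAut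

/-! ### Square-zero lifting after adding two variables -/

section Stable

open MvPolynomial

variable {n : ℕ} {A : Type*} [CommRing A] {J : Ideal A}

theorem monomial_one_eq_erase_mul (i : Fin n) (s : Fin n →₀ ℕ) :
    (monomial s 1 : MvPolynomial (Fin n) A) = monomial (s.erase i) 1 * X i ^ s i := by
  rw [X_pow_eq_monomial, monomial_mul, one_mul, Finsupp.erase_add_single]

theorem monomial_mem_supported {s : Fin n →₀ ℕ} {t : Set (Fin n)} (h : ∀ i ∈ s.support, i ∈ t) :
    (monomial s 1 : MvPolynomial (Fin n) A) ∈ supported A t := by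
  rw [monomial_eq, map_one, one_mul]
  exact prod_mem fun i hi =>
    pow_mem (show X i ∈ supported A t from Algebra.subset_adjoin ⟨i, h i hi, rfl⟩) _

theorem monomial_erase_mem_supported (i : Fin n) (s : Fin n →₀ ℕ) :
    (monomial (s.erase i) 1 : MvPolynomial (Fin n) A) ∈ supported A ({i}ᶜ : Set (Fin n)) :=
  monomial_mem_supported fun j hj => by
    rw [Finsupp.support_erase, Finset.mem_erase] at hj
    exact hj.1

/-- The divergence-free field `p ∂_i - (∂_i p) X_{n+2} ∂_{n+2}` in `n + 2` variables. -/
def stableField (i : Fin n) :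
    MvPolynomial (Fin n) A →ₗ[A] (Fin (n + 2) → MvPolynomial (Fin (n + 2)) A) :=
  LinearMap.single A (fun _ => MvPolynomial (Fin (n + 2)) A) (Fin.castAdd 2 i) ∘ₗ
      (rename (Fin.castAdd 2)).toLinearMap -
    LinearMap.single A (fun _ => MvPolynomial (Fin (n + 2)) A) (Fin.natAdd n 1) ∘ₗ
      LinearMap.mulRight A (X (Fin.natAdd n 1)) ∘ₗ (rename (Fin.castAdd 2)).toLinearMap ∘ₗ
        (pderiv i).toLinearMap

theorem stableField_apply (i : Fin n) (p : MvPolynomial (Fin n) A) :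
    stableField i p = Pi.single (Fin.castAdd 2 i) (rename (Fin.castAdd 2) p) -
      Pi.single (Fin.natAdd n 1) (rename (Fin.castAdd 2) (pderiv i p) * X (Fin.natAdd n 1)) :=
  rfl

theorem castAdd_ne_natAdd {m : ℕ} (i : Fin n) (j : Fin m) : Fin.castAdd m i ≠ Fin.natAdd n j := by
  intro h
  have := congrArg Fin.val h
  simp at this
  omega

theorem stableField_monomial_mem (hJ : J * J = ⊥) (i : Fin n) (s : Fin n →₀ ℕ) :
    stableField i (monomial s 1) ∈ tangentEA (n + 2) hJ := by
  have hq := monomial_erase_mem_supported (A := A) i s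
  have hz : ∀ j : Fin 2, rename (Fin.castAdd 2) (monomial (s.erase i) 1) ∈
      supported A ({Fin.natAdd n j}ᶜ : Set (Fin (n + 2))) := fun j =>
    rename_mem_supported _ hq fun k _ => castAdd_ne_natAdd k j
  have hx : rename (Fin.castAdd 2) (monomial (s.erase i) 1) ∈
      supported A ({Fin.castAdd 2 i}ᶜ : Set (Fin (n + 2))) :=
    rename_mem_supported _ hq fun k hk => by simpa using hk
  have h := single_pow_sub_mem_tangentEA hJ (castAdd_ne_natAdd i (0 : Fin 2))
    (castAdd_ne_natAdd i (1 : Fin 2)) (by simp [Fin.ext_iff]) hx (hz 0) (hz 1) (s i)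
  rw [stableField_apply, monomial_one_eq_erase_mul i s, Derivation.leibniz,
    pderiv_eq_zero_of_mem_supported hq, smul_zero, add_zero, smul_eq_mul, map_mul, map_mul,
    ← pderiv_rename (Fin.castAdd_injective n 2), map_pow, rename_X]
  exact h

/-- Write `h = ψ - X`. The fields attached to the components `h_i` sum to `h`, since their last
components add up to `-(div h)` times the last variable and `div h = 0`. -/
theorem stab_two_mem_EA_of_congr (hJ : J * J = ⊥) {ψ : GA n A} (hψ : ψ ∈ SA n A)
    (h1 : mapGA (Ideal.Quotient.mk J) ψ = 1) : stab 2 ψ ∈ EA (n + 2) A := by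
  have hh := coord_sub_mem_of_mapGA_eq_one h1
  have hdiv := sum_pderiv_eq_zero_of_mem_SA hJ hh hψ fun i => by ring
  have hsum : ∑ i, stableField i (coord ψ i - X i) ∈ infinitesimalEA (n + 2) hJ :=
    sum_mem fun i _ => map_mem_infinitesimalEA hJ _ (stableField_monomial_mem hJ i) (hh i)
  obtain ⟨-, χ, hχ, hc⟩ := hsum
  rw [show stab 2 ψ = χ from ext_coord fun k => ?_]
  · exact hχ
  rw [hc, coord_stab, Finset.sum_apply]
  refine Fin.addCases (fun k => ?_) (fun k => ?_) k
  · rw [Finset.sum_eq_single k]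
    · simp [stableField_apply, stabVector, castAdd_ne_natAdd]
    · intro b _ hb
      simp [stableField_apply, castAdd_ne_natAdd, hb.symm]
    · simp
  · have h0 : ∀ i, stableField i (coord ψ i - X i) (Fin.natAdd n k) = if k = 1 then
        -(rename (Fin.castAdd 2) (pderiv i (coord ψ i - X i)) * X (Fin.natAdd n 1)) else 0 := by
      intro i
      rw [stableField_apply, Pi.sub_apply, Pi.single_apply, if_neg (castAdd_ne_natAdd i k).symm,
        Pi.single_apply, zero_sub]
      split_ifs <;> simp_all
    simp only [h0]
    split_ifs
    · rw [Finset.sum_neg_distrib, ← Finset.sum_mul, ← map_sum, hdiv]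
      simp [stabVector]
    · simp [stabVector]

/-- Nilpotent lifting, stable form. -/
theorem stab_two_mem_EA (hJ : J * J = ⊥) {φ : GA n A} (hφ : φ ∈ SA n A)
    (h1 : mapGA (Ideal.Quotient.mk J) φ ∈ EA n (A ⧸ J)) : stab 2 φ ∈ EA (n + 2) A := by
  obtain ⟨ε, hε, he, -⟩ := exists_lift_EA Ideal.Quotient.mk_surjective
    (map_one (Ideal.Quotient.mk J)) h1
  have h2 : stab 2 (ε⁻¹ * φ) ∈ EA (n + 2) A := by
    refine stab_two_mem_EA_of_congr hJ (mul_mem (inv_mem (EA_le_SA hε)) hφ) ?_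
    rw [map_mul, map_inv, he, inv_mul_cancel]
  rw [map_mul, map_inv] at h2
  exact ((EA _ _).mul_mem_cancel_left (inv_mem (stab_mem_EA 2 hε))).1 h2

end Stable

end PolyAut

end

noncomputable section

namespace PolyAut

/-! ### Square-zero lifting in the plane over `ℚ` -/

section RationalCoefficients

/-- The coefficients of a polynomial curve are rational combinations of its values at `0, …, d - 1`,
by inverting a Vandermonde matrix. -/
theorem mem_of_forall_sum_pow_smul_mem {M : Type*} [AddCommGroup M] [Module ℚ M]
    (N : Submodule ℚ M) {d : ℕ} (V : Fin d → M)
    (h : ∀ t : ℕ, ∑ k : Fin d, (t : ℚ) ^ (k : ℕ) • V k ∈ N) (k : Fin d) : V k ∈ N := by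
  set W : Matrix (Fin d) (Fin d) ℚ := Matrix.vandermonde fun t : Fin d => ((t : ℕ) : ℚ) with hW
  have hdet : IsUnit W.det := by
    rw [isUnit_iff_ne_zero, hW, Matrix.det_vandermonde_ne_zero_iff]
    intro a b hab
    exact Fin.ext (Nat.cast_injective hab)
  have h1 : ∑ t, W⁻¹ k t • ∑ l, W t l • V l = V k := by
    simp only [Finset.smul_sum, smul_smul]
    rw [Finset.sum_comm]
    simp only [← Finset.sum_smul, ← Matrix.mul_apply, Matrix.nonsing_inv_mul W hdet,
      Matrix.one_apply, ite_smul, one_smul, zero_smul, Finset.sum_ite_eq, Finset.mem_univ, if_true]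
  rw [← h1]
  exact sum_mem fun t _ => N.smul_mem _ (by simpa [hW, Matrix.vandermonde_apply] using h t)

open MvPolynomial

variable {A : Type*} [CommRing A] {J : Ideal A}

theorem mem_supported_of_pderiv_eq_zero {n : ℕ} [Algebra ℚ A] {i : Fin n}
    {p : MvPolynomial (Fin n) A} (hp : pderiv i p = 0) :
    p ∈ supported A ({i}ᶜ : Set (Fin n)) := by
  rw [mem_supported]
  rintro j hj rfl
  obtain ⟨s, hs, hjs⟩ := (mem_vars_iff_mem_support j).1 hj
  have hle : Finsupp.single j 1 ≤ s := by
    rw [Finsupp.single_le_iff]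
    exact Nat.one_le_iff_ne_zero.2 (Finsupp.mem_support_iff.1 hjs)
  have h1 := congrArg (coeff (s - Finsupp.single j 1)) hp
  rw [coeff_pderiv, tsub_add_cancel_of_le hle, coeff_zero] at h1
  have hu : ∀ m : ℕ, IsUnit (m + 1 : A) := fun m => by
    rw [← Nat.cast_succ, ← map_natCast (algebraMap ℚ A)]
    exact (IsUnit.mk0 _ (by positivity)).map _
  exact mem_support_iff.1 hs ((hu _).mul_left_eq_zero.1 h1)

/-- The coefficient of `t ^ k` in `(x + t y) ^ d (∂_y - t ∂_x)`. -/
def planeField (A : Type*) [CommRing A] (d k : ℕ) : Fin 2 → MvPolynomial (Fin 2) A :=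
  Pi.single 1 ((d.choose k : MvPolynomial (Fin 2) A) * (X 0 ^ (d - k) * X 1 ^ k)) -
    Pi.single 0 (if k = 0 then 0 else
      (d.choose (k - 1) : MvPolynomial (Fin 2) A) * (X 0 ^ (d - (k - 1)) * X 1 ^ (k - 1)))

theorem sum_smul_planeField (d : ℕ) (t : A) :
    ∑ k ∈ Finset.range (d + 2), t ^ k • planeField A d k =
      (Pi.single 1 ((X 0 + C t * X 1 : MvPolynomial (Fin 2) A) ^ d) :
        Fin 2 → MvPolynomial (Fin 2) A) -
      (Pi.single 0 (C t * (X 0 + C t * X 1 : MvPolynomial (Fin 2) A) ^ d) :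
        Fin 2 → MvPolynomial (Fin 2) A) := by
  have hpow : (X 0 + C t * X 1 : MvPolynomial (Fin 2) A) ^ d = ∑ k ∈ Finset.range (d + 1),
      t ^ k • ((d.choose k : MvPolynomial (Fin 2) A) * (X 0 ^ (d - k) * X 1 ^ k)) := by
    rw [add_comm, add_pow]
    refine Finset.sum_congr rfl fun k _ => ?_
    rw [smul_eq_C_mul, map_pow]
    ring
  funext i
  rw [Finset.sum_apply]
  fin_cases i
  · change ∑ k ∈ Finset.range (d + 2), (t ^ k • planeField A d k) 0 = _
    rw [Finset.sum_range_succ']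
    simp [planeField, hpow, Finset.mul_sum, smul_eq_C_mul, pow_succ]
    refine Finset.sum_congr rfl fun k _ => by ring
  · change ∑ k ∈ Finset.range (d + 2), (t ^ k • planeField A d k) 1 = _
    rw [Finset.sum_range_succ]
    simp [planeField, hpow]

/-- Conjugating `x ^ d ∂_y` by `x ↦ x + t y` gives the whole curve `(x + t y) ^ d (∂_y - t ∂_x)`;
its coefficients follow by interpolation. -/
theorem planeField_mem_tangentEA [Algebra ℚ A] (hJ : J * J = ⊥) (d k : ℕ) (hk : k < d + 2) :
    planeField A d k ∈ tangentEA 2 hJ := by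
  refine mem_of_forall_sum_pow_smul_mem ((tangentEA 2 hJ).restrictScalars ℚ)
    (fun k : Fin (d + 2) => planeField A d k) (fun t => ?_) ⟨k, hk⟩
  have h1 : (Pi.single 1 (X 0 ^ d) : Fin 2 → MvPolynomial (Fin 2) A) ∈ tangentEA 2 hJ :=
    single_mem_tangentEA hJ (pow_mem (X_mem_supported_compl (by decide)) d)
  have hf : C (t : A) * X 1 ∈ supported A ({0}ᶜ : Set (Fin 2)) :=
    mul_mem (Subalgebra.algebraMap_mem _ _) (X_mem_supported_compl (by decide))
  have h2 := adjointElementary_mem_tangentEA hJ h1 0 ⟨_, hf⟩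
  rw [adjointElementary_single] at h2
  have h3 : ∑ k : Fin (d + 2), (t : ℚ) ^ (k : ℕ) • planeField A d k =
      ∑ k ∈ Finset.range (d + 2), (t : A) ^ k • planeField A d k := by
    rw [Finset.sum_range]
    refine Finset.sum_congr rfl fun k _ => ?_
    rw [← algebraMap_smul A, map_pow, map_natCast]
  rw [Submodule.restrictScalars_mem, h3, sum_smul_planeField]
  convert h2 using 3
  · rw [map_pow, bind₁_X_right, coord_elementary, if_pos rfl]
  · simp [coord_elementary]

theorem exists_field_mem_tangentEA [Algebra ℚ A] (hJ : J * J = ⊥) (s : Fin 2 →₀ ℕ) :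
    ∃ H ∈ tangentEA 2 hJ, H 0 = monomial s 1 ∧ pderiv 1 (H 1) = -pderiv 0 (monomial s (1 : A)) := by
  set i := s 0
  set j := s 1
  have hs : (monomial s 1 : MvPolynomial (Fin 2) A) = X 0 ^ i * X 1 ^ j := by
    rw [monomial_eq, map_one, one_mul, Finsupp.prod_fintype _ _ (by simp), Fin.prod_univ_two]
  have hc : (((i + j).choose j : ℕ) : ℚ) ≠ 0 :=
    Nat.cast_ne_zero.2 (Nat.choose_pos (Nat.le_add_left _ _)).ne'
  set c : A := algebraMap ℚ A (((i + j).choose j : ℕ) : ℚ)⁻¹ with hcdef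
  have hcc : C c * ((i + j).choose j : MvPolynomial (Fin 2) A) = 1 := by
    rw [← map_natCast C, ← map_natCast (algebraMap ℚ A), ← map_mul, ← map_mul,
      inv_mul_cancel₀ hc, map_one, map_one]
  -- The `∂_x`-component of this coefficient is `-(i + j).choose j` times `x ^ i y ^ j`, and the
  -- binomial is invertible.
  refine ⟨-(c • planeField A (i + j) (j + 1)), neg_mem (Submodule.smul_mem _ _
    (planeField_mem_tangentEA hJ _ _ (by omega))), ?_, ?_⟩
  · rw [hs]
    simp only [planeField, Pi.neg_apply, Pi.smul_apply, Pi.sub_apply, smul_eq_C_mul]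
    simp
    linear_combination (X 0 ^ i * X 1 ^ j : MvPolynomial (Fin 2) A) * hcc
  · have hch : ((i + j).choose (j + 1) : MvPolynomial (Fin 2) A) * (j + 1) =
        (i + j).choose j * i := by
      have := Nat.choose_succ_right_eq (i + j) j
      rw [Nat.add_sub_cancel] at this
      rw [← Nat.cast_succ, ← Nat.cast_mul, ← Nat.cast_mul, this]
    -- For `i = 0` the subtraction truncates, but then the binomial coefficient in front vanishes.
    have hd : i + j - (j + 1) = i - 1 := by omega
    rw [hs]
    simp only [planeField, Pi.neg_apply, Pi.smul_apply, Pi.sub_apply, smul_eq_C_mul, hd]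
    simp [Derivation.leibniz, Derivation.leibniz_pow, pderiv_X]
    linear_combination (X 0 ^ (i - 1) * X 1 ^ j : MvPolynomial (Fin 2) A) * (C c * hch + i * hcc)

/-- A field from `tangentEA` matches the first component of `h` and has divergence zero. The
remaining second component has zero derivative in `X 1`, so in characteristic zero it does not
involve `X 1` and is elementary. -/
theorem mem_EA_two_of_congr [Algebra ℚ A] (hJ : J * J = ⊥) {ψ : GA 2 A} (hψ : ψ ∈ SA 2 A)
    (h1 : mapGA (Ideal.Quotient.mk J) ψ = 1) : ψ ∈ EA 2 A := by
  have hh := coord_sub_mem_of_mapGA_eq_one h1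
  have hdiv := sum_pderiv_eq_zero_of_mem_SA hJ hh hψ fun i => by ring
  set h : Fin 2 → MvPolynomial (Fin 2) A := fun i => coord ψ i - X i with hdef
  rw [Fin.sum_univ_two] at hdiv
  choose W hW hW0 hW1 using exists_field_mem_tangentEA (A := A) hJ
  set L := (basisMonomials (Fin 2) A).constr A W with hLdef
  have hL : ∀ s, L (monomial s 1) = W s := fun s => by
    rw [hLdef, show monomial s 1 = basisMonomials (Fin 2) A s by rw [coe_basisMonomials],
      Module.Basis.constr_basis]
  have hL0 : ∀ p, L p 0 = p := by
    intro p
    have : LinearMap.proj 0 ∘ₗ L = LinearMap.id := by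
      refine (basisMonomials (Fin 2) A).ext fun s => ?_
      simp only [coe_basisMonomials, LinearMap.comp_apply, hL, LinearMap.proj_apply, hW0,
        LinearMap.id_apply]
    exact LinearMap.congr_fun this p
  have hL1 : ∀ p, pderiv 1 (L p 1) = -pderiv 0 p := by
    intro p
    have : (pderiv 1 : Derivation A (MvPolynomial (Fin 2) A) _).toLinearMap ∘ₗ
        LinearMap.proj 1 ∘ₗ L =
        -(pderiv 0 : Derivation A (MvPolynomial (Fin 2) A) _).toLinearMap := by
      refine (basisMonomials (Fin 2) A).ext fun s => ?_
      simp only [coe_basisMonomials, LinearMap.comp_apply, hL, LinearMap.proj_apply,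
        LinearMap.neg_apply]
      exact hW1 s
    exact LinearMap.congr_fun this p
  have hmem : L (h 0) ∈ infinitesimalEA 2 hJ :=
    map_mem_infinitesimalEA hJ L (fun s => by rw [hL]; exact hW s) (hh 0)
  have hg : h 1 - L (h 0) 1 ∈ supported A ({1}ᶜ : Set (Fin 2)) := by
    refine mem_supported_of_pderiv_eq_zero ?_
    rw [map_sub, hL1, ← hdiv]
    simp only [hdef]
    ring
  have hmem' : (Pi.single 1 (h 1 - L (h 0) 1) : Fin 2 → MvPolynomial (Fin 2) A) ∈
      infinitesimalEA 2 hJ := by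
    refine mem_infinitesimalEA_of_coord hJ (fun i => ?_) (elementary_mem_EA 1 ⟨_, hg⟩) fun i => ?_
    · rw [Pi.single_apply]
      split_ifs
      · exact sub_mem (hh 1) (hmem.1 1)
      · exact zero_mem _
    · rw [coord_elementary, Pi.single_apply]
      split_ifs with hi
      · rw [hi]
      · rw [add_zero]
  obtain ⟨-, χ, hχ, hc⟩ := add_mem hmem hmem'
  rw [show ψ = χ from ext_coord fun k => ?_]
  · exact hχ
  rw [hc]
  fin_cases k
  · simp [hL0, hdef]
  · simp [hdef]

/-- Nilpotent lifting for the affine plane over a `ℚ`-algebra. -/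
theorem mem_EA_two_of_mapGA_mem [Algebra ℚ A] (hJ : J * J = ⊥) {φ : GA 2 A} (hφ : φ ∈ SA 2 A)
    (h1 : mapGA (Ideal.Quotient.mk J) φ ∈ EA 2 (A ⧸ J)) : φ ∈ EA 2 A := by
  obtain ⟨ε, hε, he, -⟩ := exists_lift_EA Ideal.Quotient.mk_surjective
    (map_one (Ideal.Quotient.mk J)) h1
  have h2 : ε⁻¹ * φ ∈ EA 2 A := by
    refine mem_EA_two_of_congr hJ (mul_mem (inv_mem (EA_le_SA hε)) hφ) ?_
    rw [map_mul, map_inv, he, inv_mul_cancel]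
  exact ((EA _ _).mul_mem_cancel_left (inv_mem hε)).1 h2

end RationalCoefficients

end PolyAut

end

noncomputable section

namespace PolyAut

/-! ### Lifting along nilpotent ideals -/

section NilpotentLifting

open MvPolynomial

variable {n : ℕ} {R S T : Type*} [CommRing R] [CommRing S] [CommRing T]

theorem stab_add_two (m : ℕ) (φ : GA n R) :
    (stab (m + 2) φ : GA (n + m + 2) R) = stab 2 (stab m φ) := by
  suffices h : ∀ k : Fin (n + m + 2), coord (stab (m + 2) φ) k = coord (stab 2 (stab m φ)) k from
    ext_coord h
  intro k
  induction k using Fin.addCases (m := n + m) (n := 2) with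
  | left k =>
    induction k using Fin.addCases (m := n) (n := m) with
    | left i =>
      have h : coord (stab (m + 2) φ) (Fin.castAdd (m + 2) i) =
          rename (Fin.castAdd (m + 2)) (coord φ i) := by
        rw [coord_stab, stabVector, Fin.append_left]
      refine h.trans ?_
      rw [coord_stab, stabVector, Fin.append_left, coord_stab, stabVector, Fin.append_left,
        rename_rename]
      rfl
    | right j =>
      have h : coord (stab (m + 2) φ) (Fin.natAdd n (Fin.castAdd 2 j)) =
          X (Fin.natAdd n (Fin.castAdd 2 j)) := by
        rw [coord_stab, stabVector, Fin.append_right]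
      refine h.trans ?_
      rw [coord_stab, stabVector, Fin.append_left, coord_stab, stabVector, Fin.append_right,
        rename_X]
      rfl
  | right j =>
    have hk : (Fin.natAdd (n + m) j : Fin (n + (m + 2))) = Fin.natAdd n (Fin.natAdd m j) :=
      Fin.ext (Nat.add_assoc n m j)
    have h : coord (stab (m + 2) φ) (Fin.natAdd n (Fin.natAdd m j)) =
        X (Fin.natAdd n (Fin.natAdd m j)) := by
      rw [coord_stab, stabVector, Fin.append_right]
    refine (congrArg (coord (stab (m + 2) φ)) hk).trans (h.trans ?_)
    rw [coord_stab, stabVector, Fin.append_right]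
    exact congrArg X hk.symm

/-- An elementary lift of the image under `f` has the same image under `g` as `φ` itself. -/
theorem mapGA_mem_EA_of_ker_le {f : R →+* S} {g : R →+* T} (hf : Function.Surjective f)
    (h : RingHom.ker f ≤ RingHom.ker g) {φ : GA n R} (hφ : mapGA f φ ∈ EA n S) :
    mapGA g φ ∈ EA n T := by
  obtain ⟨ε, hε, he, -⟩ := exists_lift_EA hf (map_one f) hφ
  rw [← mapGA_eq_of_ker_le f g h he]
  exact mapGA_mem_EA g hε

theorem mapGA_mk_map_mem_EA {I K : Ideal R} {φ : GA n R}
    (hφ : mapGA (Ideal.Quotient.mk K) φ ∈ EA n (R ⧸ K)) :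
    mapGA (Ideal.Quotient.mk (K.map (Ideal.Quotient.mk I))) (mapGA (Ideal.Quotient.mk I) φ) ∈
      EA n ((R ⧸ I) ⧸ K.map (Ideal.Quotient.mk I)) := by
  rw [mapGA_mapGA]
  refine mapGA_mem_EA_of_ker_le Ideal.Quotient.mk_surjective (fun x hx => ?_) hφ
  rw [Ideal.mk_ker] at hx
  exact Ideal.Quotient.eq_zero_iff_mem.2 (Ideal.mem_map_of_mem _ hx)

/-- Induction through square-zero extensions, each costing two more variables. -/
theorem exists_stab_mem_EA_of_isNilpotent {I : Ideal R} (hI : IsNilpotent I) {φ : GA n R}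
    (hφ : φ ∈ SA n R)
    (h : ∃ m, mapGA (Ideal.Quotient.mk I) (stab m φ) ∈ EA (n + m) (R ⧸ I)) :
    ∃ m, stab m φ ∈ EA (n + m) R := by
  refine Ideal.IsNilpotent.induction_on (S := R) I hI
    (P := fun S _ I => ∀ φ ∈ SA n S,
      (∃ m, mapGA (Ideal.Quotient.mk I) (stab m φ) ∈ EA (n + m) (S ⧸ I)) →
      ∃ m, stab m φ ∈ EA (n + m) S) ?_ ?_ φ hφ h
  · rintro S _ I hI φ hφ ⟨m, hm⟩
    refine ⟨m + 2, ?_⟩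
    have h := stab_two_mem_EA ((sq I).symm.trans hI) (stab_mem_SA m hφ) hm
    rw [← stab_add_two] at h
    exact h
  · rintro S _ I K - hI hK φ hφ ⟨m, hm⟩
    refine hI φ hφ ?_
    obtain ⟨m', hm'⟩ := hK (mapGA (Ideal.Quotient.mk I) φ) (mapGA_mem_SA _ hφ)
      ⟨m, by rw [← mapGA_stab]; exact mapGA_mk_map_mem_EA hm⟩
    exact ⟨m', by rw [mapGA_stab]; exact hm'⟩

theorem mem_EA_two_of_isNilpotent [Algebra ℚ R] {I : Ideal R} (hI : IsNilpotent I) {φ : GA 2 R}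
    (hφ : φ ∈ SA 2 R) (h : mapGA (Ideal.Quotient.mk I) φ ∈ EA 2 (R ⧸ I)) : φ ∈ EA 2 R := by
  -- The motive ranges over bare rings, so the `ℚ`-algebra structure is carried as a `Nonempty`
  -- hypothesis, inherited by quotients.
  refine Ideal.IsNilpotent.induction_on (S := R) I hI
    (P := fun S _ I => Nonempty (Algebra ℚ S) → ∀ φ ∈ SA 2 S,
      mapGA (Ideal.Quotient.mk I) φ ∈ EA 2 (S ⧸ I) → φ ∈ EA 2 S) ?_ ?_ ⟨inferInstance⟩ φ hφ h
  · rintro S _ I hI ⟨_⟩ φ hφ h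
    exact mem_EA_two_of_mapGA_mem ((sq I).symm.trans hI) hφ h
  · rintro S _ I K - hI hK ⟨_⟩ φ hφ h
    exact hI ⟨inferInstance⟩ φ hφ (hK ⟨inferInstance⟩ _ (mapGA_mem_SA _ hφ) (mapGA_mk_map_mem_EA h))

end NilpotentLifting

/-! ### The reduced quotient of an Artinian ring -/

section Artinian

open MvPolynomial

variable {A : Type*} [CommRing A] [IsArtinianRing A]

/-- The maximal ideals are treated one at a time. Each correction is lifted with its polynomials
multiplied by a Chinese-remainder element, which is 1 modulo the current ideal and 0 modulo the
others, so earlier congruences persist. -/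
theorem exists_EA_two_mul_congr_one {φ : GA 2 A} (hφ : φ ∈ SA 2 A)
    (s : Finset (MaximalSpectrum A)) :
    ∃ ε ∈ EA 2 A, ∀ 𝔪 ∈ s, mapGA (Ideal.Quotient.mk 𝔪.asIdeal) (ε * φ) = 1 := by
  classical
  induction s using Finset.induction_on with
  | empty => exact ⟨1, one_mem _, by simp⟩
  | insert 𝔪 s h𝔪 ih =>
    obtain ⟨ε, hε, h⟩ := ih
    have hcop : Pairwise (Function.onFun IsCoprime (MaximalSpectrum.asIdeal (R := A))) :=
      fun 𝔭 𝔮 hne => Ideal.isCoprime_of_isMaximal fun heq => hne (MaximalSpectrum.ext heq)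
    obtain ⟨e, he⟩ := Ideal.exists_forall_sub_mem_ideal hcop (Pi.single 𝔪 (1 : A))
    have he1 : Ideal.Quotient.mk 𝔪.asIdeal e = 1 := by
      have := he 𝔪
      rwa [Pi.single_eq_same, ← Ideal.Quotient.eq, map_one] at this
    let _ : Field (A ⧸ 𝔪.asIdeal) := Ideal.Quotient.field 𝔪.asIdeal
    have hψ : (mapGA (Ideal.Quotient.mk 𝔪.asIdeal) (ε * φ))⁻¹ ∈ EA 2 (A ⧸ 𝔪.asIdeal) :=
      inv_mem (SA_two_le_EA_two (mapGA_mem_SA _ (mul_mem (EA_le_SA hε) hφ)))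
    obtain ⟨δ, hδ, h1, h2⟩ := exists_lift_EA Ideal.Quotient.mk_surjective he1 hψ
    refine ⟨δ * ε, mul_mem hδ hε, fun 𝔭 h𝔭 => ?_⟩
    rw [mul_assoc, map_mul]
    rcases Finset.mem_insert.1 h𝔭 with rfl | h𝔭
    · rw [h1, inv_mul_cancel]
    · have hne : 𝔭 ≠ 𝔪 := fun heq => h𝔪 (heq ▸ h𝔭)
      have hmem := he 𝔭
      rw [Pi.single_eq_of_ne hne, sub_zero] at hmem
      rw [h2 _ hmem, h 𝔭 h𝔭, one_mul]

/-- In an Artinian ring the nilradical is the intersection of the finitely many maximal ideals, so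
congruences modulo all of them combine coefficientwise. -/
theorem mapGA_nilradical_mem_EA {φ : GA 2 A} (hφ : φ ∈ SA 2 A) :
    mapGA (Ideal.Quotient.mk (nilradical A)) φ ∈ EA 2 (A ⧸ nilradical A) := by
  have := Fintype.ofFinite (MaximalSpectrum A)
  obtain ⟨ε, hε, h⟩ := exists_EA_two_mul_congr_one hφ Finset.univ
  have h1 : mapGA (Ideal.Quotient.mk (nilradical A)) (ε * φ) = 1 := by
    refine ext_coord fun i => ?_
    rw [coord_mapGA, coord_one, ← map_X (Ideal.Quotient.mk (nilradical A)), ← sub_eq_zero,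
      ← map_sub]
    ext s
    rw [coeff_map, coeff_zero, Ideal.Quotient.eq_zero_iff_mem, IsArtinianRing.nilradical_eq_iInf,
      Submodule.mem_iInf]
    exact fun 𝔪 => mem_map_C_iff.1 (coord_sub_mem_of_mapGA_eq_one (h 𝔪 (Finset.mem_univ _)) i) s
  rw [map_mul] at h1
  exact ((EA _ _).mul_mem_cancel_left (mapGA_mem_EA _ hε)).1 (h1 ▸ one_mem _)

end Artinian

end PolyAut

end

theorem theorem4p3 {A : Type*} [CommRing A] [IsArtinianRing A]
    (φ : PolyAut.GA 2 A) (hφ : φ ∈ PolyAut.SA 2 A) :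
    (∃ m : ℕ, PolyAut.stab m φ ∈ PolyAut.EA (2 + m) A) ∧
      (Nonempty (Algebra ℚ A) → φ ∈ PolyAut.EA 2 A) := by
  have h := PolyAut.mapGA_nilradical_mem_EA hφ
  -- Modulo the nilradical no extra variable is needed, hence the witness `0`.
  refine ⟨PolyAut.exists_stab_mem_EA_of_isNilpotent IsArtinianRing.isNilpotent_nilradical hφ
    ⟨0, ?_⟩, ?_⟩
  · rw [PolyAut.mapGA_stab]
    exact PolyAut.stab_mem_EA 0 h
  · rintro ⟨_⟩
    exact PolyAut.mem_EA_two_of_isNilpotent IsArtinianRing.isNilpotent_nilradical hφ h
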